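/- Consider fair division instances consisting of $n$ agents, a finite set $M$ of items, additive valuations $v_i : 2^M \to \mathbb{R}$ (one per agent $i$), and a partition of $M$ into $\ell$ categories, where each category $C$ has a lower quota $q_C^- \in \mathbb{Z}_{\ge 0}$ and an upper quota $q_C^+ \in \mathbb{Z}_{\ge 0}$ such that $q_C^- n \le |C| \le q_C^+ n$. An allocation is an ordered partition $(A_i)_i$ of $M$ into one bundle per agent; it is feasible if $q_C^- \le |A_i \cap C| \le q_C^+$ for every agent $i$ and every category $C$. The maximin share of agent $i$ is $$\mu_i = \max\{\min_k v_i(P_k) : (P_k)_k \text{ a feasible allocation}\},$$ and, for $\alpha\in\mathbb{R}$, a feasible allocation $(A_i)_i$ is an $\alpha$-MMS allocation if $v_i(A_i) \ge \alpha\, \mu_i$ for all $i$. An instance is of goods (of chores) if $v_i(g) \ge 0$ (respectively $v_i(g) \le 0$) for all agents $i$ and items $g$. The agents are almost identical if all but at most one of their valuations are equal as functions. Running time is the number of elementary operations in the uniform cost model (a random access machine with natural and real memory cells, which holds the item values in its memory). **Corollary.** Let the number $n$ of agents and the number $\ell$ of categories be constants. There is an algorithm that, given any real $\varepsilon > 0$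 and any instance of goods with $n$ almost identical agents and $\ell$ categories, computes a $(1-\varepsilon)$-MMS allocation in time polynomial in $|M|$ and $\varepsilon^{-1}$. Likewise, there is an algorithm that, given any real $\varepsilon > 0$ and any instance of chores with $n$ almost identical agents and $\ell$ categories, computes a $(1+\varepsilon)$-MMS allocation in time polynomial in $|M|$ and $\varepsilon^{-1}$. In particular, both apply to every two-agent instance, because two agents are always almost identical. -/

import Mathlib

open Finset

/-! ### Fair division instances with category-wise lower and upper quotas -/

/-- An instance with agents `Fin n`, items `Fin m`, and the items partitioned into `ℓ` (possibly
empty) categories: `cat g` is the category of the item `g`.  Valuations are additive, so they are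
given by the real value `val i g` of each item `g` for each agent `i`.  The category `j` has a
lower quota `lo j` and an upper quota `hi j`, with `lo j * n ≤ |C_j| ≤ hi j * n`. -/
structure FDInstance (n ℓ m : ℕ) where
  val : Fin n → Fin m → ℝ
  cat : Fin m → Fin ℓ
  lo : Fin ℓ → ℕ
  hi : Fin ℓ → ℕ
  lo_mul_le : ∀ j, lo j * n ≤ #{g | cat g = j}
  le_hi_mul : ∀ j, #{g | cat g = j} ≤ hi j * n

namespace FDInstance

variable {n ℓ m : ℕ}

/-- The additive valuation of agent `i` on bundles. -/
noncomputable def value (I : FDInstance n ℓ m) (i : Fin n) (S : Finset (Fin m)) : ℝ :=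
  ∑ g ∈ S, I.val i g

/-- A bundle is feasible if it respects both quotas of every category. -/
def FeasibleBundle (I : FDInstance n ℓ m) (S : Finset (Fin m)) : Prop :=
  ∀ j, I.lo j ≤ #{g ∈ S | I.cat g = j} ∧ #{g ∈ S | I.cat g = j} ≤ I.hi j

/-- A feasible allocation: an ordered partition of the items into feasible bundles, one for
each agent. -/
def FeasibleAllocation (I : FDInstance n ℓ m) (A : Fin n → Finset (Fin m)) : Prop :=
  (∀ g, ∃! i, g ∈ A i) ∧ ∀ i, I.FeasibleBundle (A i)

/-- The maximin share of agent `i`: the maximum, over the (finitely many) feasible allocations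
`P`, of the least value for `i` of a bundle of `P`. -/
noncomputable def mms (I : FDInstance n ℓ m) (i : Fin n) : ℝ :=
  sSup {x : ℝ | ∃ P : Fin n → Finset (Fin m),
    I.FeasibleAllocation P ∧ x = ⨅ k : Fin n, I.value i (P k)}

/-- `A` is an `α`-MMS allocation. -/
def IsMMSAllocation (I : FDInstance n ℓ m) (α : ℝ) (A : Fin n → Finset (Fin m)) : Prop :=
  I.FeasibleAllocation A ∧ ∀ i, α * I.mms i ≤ I.value i (A i)

/-- Instances of goods. -/
def IsGoods (I : FDInstance n ℓ m) : Prop := ∀ i g, 0 ≤ I.val i g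

/-- Instances of chores. -/
def IsChores (I : FDInstance n ℓ m) : Prop := ∀ i g, I.val i g ≤ 0

/-- The agents are almost identical: there is a set of at most one agent such that the valuations
of all other agents are equal as functions on bundles. -/
def AlmostIdentical (I : FDInstance n ℓ m) : Prop :=
  ∃ E : Finset (Fin n), #E ≤ 1 ∧ ∀ i i', i ∉ E → i' ∉ E → I.value i = I.value i'

end FDInstance

/-! ### A random access machine with uniform cost

Programs are finite, and work on finitely many arrays of natural numbers and finitely many arrays
of real numbers, with indirect addressing.  Every operation has unit cost.  The only arithmetic is
addition, subtraction (truncated on the naturals) and comparison, and the only constants are natural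
numbers; there is no multiplication, division, rounding or conversion between the two sorts.  So
neither can long computations be packed into the digits of a single number, nor can information
be hidden in a real constant. -/

namespace RAM

/-- The memory: `nat a k` is cell `k` of the `a`-th array of naturals, and `real a k` is cell `k`
of the `a`-th array of reals. -/
structure Memory where
  nat : ℕ → ℕ → ℕ
  real : ℕ → ℕ → ℝ

/-- Expressions of natural number type; `read a e` is the content of cell `e` of array `a`. -/
inductive NatExpr : Type
  | const (c : ℕ)
  | read (a : ℕ) (e : NatExpr)
  | add (e₁ e₂ : NatExpr)
  | sub (e₁ e₂ : NatExpr)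

/-- Expressions of real type; `read a e` is the content of cell `e` of array `a`. -/
inductive RealExpr : Type
  | const (c : ℕ)
  | read (a : ℕ) (e : NatExpr)
  | add (e₁ e₂ : RealExpr)
  | sub (e₁ e₂ : RealExpr)

/-- Boolean tests. -/
inductive Test : Type
  | natLe (e₁ e₂ : NatExpr)
  | realLe (e₁ e₂ : RealExpr)
  | not (b : Test)
  | and (b₁ b₂ : Test)

/-- Programs. -/
inductive Program : Type
  | skip
  | setNat (a : ℕ) (e₁ e₂ : NatExpr)
  | setReal (a : ℕ) (e₁ : NatExpr) (e₂ : RealExpr)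
  | seq (p₁ p₂ : Program)
  | ite (b : Test) (p₁ p₂ : Program)
  | while (b : Test) (p : Program)

namespace NatExpr

/-- The value of an expression. -/
def eval (s : Memory) : NatExpr → ℕ
  | const c => c
  | read a e => s.nat a (e.eval s)
  | add e₁ e₂ => e₁.eval s + e₂.eval s
  | sub e₁ e₂ => e₁.eval s - e₂.eval s

/-- The number of elementary operations in the evaluation of an expression. -/
def cost : NatExpr → ℕ
  | const _ => 1
  | read _ e => e.cost + 1
  | add e₁ e₂ => e₁.cost + e₂.cost + 1
  | sub e₁ e₂ => e₁.cost + e₂.cost + 1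

end NatExpr

namespace RealExpr

/-- The value of an expression. -/
noncomputable def eval (s : Memory) : RealExpr → ℝ
  | const c => c
  | read a e => s.real a (e.eval s)
  | add e₁ e₂ => e₁.eval s + e₂.eval s
  | sub e₁ e₂ => e₁.eval s - e₂.eval s

/-- The number of elementary operations in the evaluation of an expression. -/
def cost : RealExpr → ℕ
  | const _ => 1
  | read _ e => e.cost + 1
  | add e₁ e₂ => e₁.cost + e₂.cost + 1
  | sub e₁ e₂ => e₁.cost + e₂.cost + 1

end RealExpr

namespace Test

/-- The test succeeds. -/
def Holds (s : Memory) : Test → Prop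
  | natLe e₁ e₂ => e₁.eval s ≤ e₂.eval s
  | realLe e₁ e₂ => e₁.eval s ≤ e₂.eval s
  | not b => ¬ b.Holds s
  | and b₁ b₂ => b₁.Holds s ∧ b₂.Holds s

/-- The number of elementary operations in a test. -/
def cost : Test → ℕ
  | natLe e₁ e₂ => e₁.cost + e₂.cost + 1
  | realLe e₁ e₂ => e₁.cost + e₂.cost + 1
  | not b => b.cost + 1
  | and b₁ b₂ => b₁.cost + b₂.cost + 1

end Test

/-- The memory after storing `x` in cell `k` of the `a`-th array of naturals. -/
def Memory.setNat (s : Memory) (a k x : ℕ) : Memory where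
  nat := fun a' k' => if a' = a ∧ k' = k then x else s.nat a' k'
  real := s.real

/-- The memory after storing `x` in cell `k` of the `a`-th array of reals. -/
noncomputable def Memory.setReal (s : Memory) (a k : ℕ) (x : ℝ) : Memory where
  nat := s.nat
  real := fun a' k' => if a' = a ∧ k' = k then x else s.real a' k'

/-- `Exec p s s' t`: started on the memory `s`, the program `p` halts after exactly `t` elementary
operations with the memory `s'`. -/
inductive Exec : Program → Memory → Memory → ℕ → Prop
  | skip (s : Memory) : Exec .skip s s 1
  | setNat (s : Memory) (a : ℕ) (e₁ e₂ : NatExpr) :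
      Exec (.setNat a e₁ e₂) s (s.setNat a (e₁.eval s) (e₂.eval s)) (e₁.cost + e₂.cost + 1)
  | setReal (s : Memory) (a : ℕ) (e₁ : NatExpr) (e₂ : RealExpr) :
      Exec (.setReal a e₁ e₂) s (s.setReal a (e₁.eval s) (e₂.eval s)) (e₁.cost + e₂.cost + 1)
  | seq {p₁ p₂ : Program} {s s₁ s₂ : Memory} {t₁ t₂ : ℕ} :
      Exec p₁ s s₁ t₁ → Exec p₂ s₁ s₂ t₂ → Exec (.seq p₁ p₂) s s₂ (t₁ + t₂)
  | ite_true {b : Test} {p₁ p₂ : Program} {s s' : Memory} {t : ℕ} :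
      b.Holds s → Exec p₁ s s' t → Exec (.ite b p₁ p₂) s s' (b.cost + t)
  | ite_false {b : Test} {p₁ p₂ : Program} {s s' : Memory} {t : ℕ} :
      ¬ b.Holds s → Exec p₂ s s' t → Exec (.ite b p₁ p₂) s s' (b.cost + t)
  | while_true {b : Test} {p : Program} {s s₁ s₂ : Memory} {t₁ t₂ : ℕ} :
      b.Holds s → Exec p s s₁ t₁ → Exec (.while b p) s₁ s₂ t₂ →
        Exec (.while b p) s s₂ (b.cost + t₁ + t₂)
  | while_false {b : Test} {p : Program} {s : Memory} :
      ¬ b.Holds s → Exec (.while b p) s s b.cost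

end RAM

namespace FDInstance

variable {n ℓ m : ℕ}

/-- The initial memory on input `(I, ε)`.  Naturals: array `0` holds the number `m` of items,
array `1` the categories of the items, arrays `2` and `3` the lower and the upper quotas.  Reals:
array `0` holds `ε`, and array `i + 1` the values of the items for agent `i`.  All other cells
are zero. -/
noncomputable def initMemory (I : FDInstance n ℓ m) (ε : ℝ) : RAM.Memory where
  nat := fun a k =>
    if a = 0 ∧ k = 0 then m
    else if h : a = 1 ∧ k < m then I.cat ⟨k, h.2⟩
    else if h : a = 2 ∧ k < ℓ then I.lo ⟨k, h.2⟩
    else if h : a = 3 ∧ k < ℓ then I.hi ⟨k, h.2⟩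
    else 0
  real := fun a k =>
    if a = 0 ∧ k = 0 then ε
    else if h : (1 ≤ a ∧ a - 1 < n) ∧ k < m then I.val ⟨a - 1, h.1.2⟩ ⟨k, h.2⟩
    else 0

/-- The output read off a final memory: item `g` goes to the agent whose number is in cell `g` of
the array `4` of naturals (and to nobody if there is no such agent). -/
def outputAllocation (n m : ℕ) (s : RAM.Memory) : Fin n → Finset (Fin m) :=
  fun i => {g | s.nat 4 g = i}

/-- On input `(I, ε)`, the program halts within `T` elementary operations, and its output is an
`α`-MMS allocation for `I`. -/
def ComputesMMS (p : RAM.Program) (I : FDInstance n ℓ m) (ε α T : ℝ) : Prop :=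
  ∃ (s : RAM.Memory) (t : ℕ), RAM.Exec p (I.initMemory ε) s t ∧ (t : ℝ) ≤ T ∧
    I.IsMMSAllocation α (outputAllocation n m s)

end FDInstance

/-! The algorithm is cut-and-choose combined with an approximation scheme. Let `u` be the valuation
shared by all agents except possibly one agent `e`. It suffices to find a feasible allocation all of
whose bundles have `u`-value at least `α` times the maximin share for `u`. Then `e` takes its
favourite bundle, which is worth at least the average and hence at least its full share
(`mms_le_of_forall_le`), and the others accept any of the remaining bundles. Permuting bundles
preserves feasibility because the quotas do not depend on the agent.

To find the allocation, fix an integer `k ≥ 1/ε` and an item `w` as unit, and replace each value `|u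
g|` by `r g`, the quotient of `m k |u g|` by `|u w|`, rounded down and capped at `m² k`. A bundle
loses at most `m` rounding units of size `|u w| / (m k)`, that is, `|u w| / k`. For goods, the right
unit is the most valuable item of a poorest bundle in an optimal allocation, so that `u w ≤ μ ≤ m *
u w` for the share `μ`. The upper bound on `u w` makes the loss at most `μ / k`, and a bundle with a
capped item is worth at least `m * u w ≥ μ` anyway. For chores, the unit is a worst item: some
bundle contains it, so `|u w| ≤ |μ|`, and the cap is harmless. The unit is not known, so every item
is tried. See `bundleSum_goods_of_round`, `bundleSum_chores_of_round` and `mul_mms_le_of_search`.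

For constant `n` and `ℓ`, the category counts and rounded values of all bundles take polynomially
many combinations. They are written as the digits of one natural number, the key, which is additive
over the items (`key_weight`). A dynamic program over keys reconstructs one allocation per
attainable key (`run_tableProg`, `run_traceProg`). The one with the key of an optimal allocation has
the same counts, hence is feasible, and the same rounded values (`eq_of_key_eq`). Candidates are
compared by their true values.

Running time is treated uniformly: a fixed program whose loops make at most `N` rounds runs in time
polynomial in `N` (`polyBdd_timeBound`), and `N` may be taken polynomial in `m` and `1/ε`
(`polyBdd_loopBound`). -/

/-! ### Polynomially bounded functions -/

/-- A function on the naturals that is bounded by a polynomial. -/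
@[fun_prop]
def PolyBdd (f : ℕ → ℕ) : Prop := ∃ c d : ℕ, ∀ N, f N ≤ c * (N + 1) ^ d

namespace PolyBdd

@[fun_prop]
theorem const (c : ℕ) : PolyBdd fun _ => c := ⟨c, 0, by simp⟩

@[fun_prop]
theorem id : PolyBdd fun N => N := ⟨1, 1, by simp⟩

@[fun_prop]
theorem add {f g : ℕ → ℕ} (hf : PolyBdd f) (hg : PolyBdd g) : PolyBdd fun N => f N + g N := by
  obtain ⟨c, d, hf⟩ := hf
  obtain ⟨c', d', hg⟩ := hg
  refine ⟨c + c', d + d', fun N => ?_⟩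
  have h1 : (N + 1) ^ d ≤ (N + 1) ^ (d + d') := Nat.pow_le_pow_right (by omega) (by omega)
  have h2 : (N + 1) ^ d' ≤ (N + 1) ^ (d + d') := Nat.pow_le_pow_right (by omega) (by omega)
  calc f N + g N ≤ c * (N + 1) ^ d + c' * (N + 1) ^ d' := add_le_add (hf N) (hg N)
    _ ≤ c * (N + 1) ^ (d + d') + c' * (N + 1) ^ (d + d') := by gcongr
    _ = _ := by ring

@[fun_prop]
theorem mul {f g : ℕ → ℕ} (hf : PolyBdd f) (hg : PolyBdd g) : PolyBdd fun N => f N * g N := by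
  obtain ⟨c, d, hf⟩ := hf
  obtain ⟨c', d', hg⟩ := hg
  refine ⟨c * c', d + d', fun N => ?_⟩
  calc f N * g N ≤ (c * (N + 1) ^ d) * (c' * (N + 1) ^ d') := Nat.mul_le_mul (hf N) (hg N)
    _ = _ := by ring

@[fun_prop]
theorem pow {f : ℕ → ℕ} (hf : PolyBdd f) (k : ℕ) : PolyBdd fun N => f N ^ k := by
  induction k with
  | zero => simpa using const 1
  | succ k ih => simpa only [pow_succ] using ih.mul hf

@[fun_prop]
theorem comp {f g : ℕ → ℕ} (hf : PolyBdd f) (hg : PolyBdd g) : PolyBdd fun N => f (g N) := by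
  obtain ⟨c, d, hf⟩ := hf
  obtain ⟨c', d', hg'⟩ := ((hg.add (const 1)).pow d).mul (const c)
  refine ⟨c', d', fun N => (hf _).trans ((le_of_eq ?_).trans (hg' N))⟩
  ring

end PolyBdd

/-! ### A program logic for total correctness and running time -/

namespace RAM

/-! ### Reading a modified memory -/

namespace Memory

variable (s : Memory) (a k x a' k' : ℕ) (y : ℝ)

@[simp] theorem nat_setNat_apply :
    (s.setNat a k x).nat a' k' = if a' = a ∧ k' = k then x else s.nat a' k' := rfl

@[simp] theorem nat_setNat_of_ne (h : a' ≠ a) : (s.setNat a k x).nat a' = s.nat a' := by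
  funext k'; simp [h]

@[simp] theorem real_setNat : (s.setNat a k x).real = s.real := rfl

@[simp] theorem nat_setReal : (s.setReal a k y).nat = s.nat := rfl

@[simp] theorem real_setReal_apply :
    (s.setReal a k y).real a' k' = if a' = a ∧ k' = k then y else s.real a' k' := rfl

@[simp] theorem real_setReal_of_ne (h : a' ≠ a) : (s.setReal a k y).real a' = s.real a' := by
  funext k'; simp [h]

end Memory

attribute [simp] NatExpr.eval RealExpr.eval Test.Holds

/-! ### Derived expressions -/

/-- The cell `0` of an array, used as a variable. -/
abbrev NatExpr.var (a : ℕ) : NatExpr := .read a (.const 0)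

/-- The multiple of an expression by a fixed number. -/
def NatExpr.smul : ℕ → NatExpr → NatExpr
  | 0, _ => .const 0
  | c + 1, e => .add (NatExpr.smul c e) e

@[simp] theorem NatExpr.eval_smul (s : Memory) (c : ℕ) (e : NatExpr) :
    (NatExpr.smul c e).eval s = c * e.eval s := by
  induction c with
  | zero => simp [NatExpr.smul]
  | succ c ih => simp [NatExpr.smul, ih, add_mul]

/-- Strict comparison of naturals. -/
abbrev Test.natLt (e₁ e₂ : NatExpr) : Test := .not (.natLe e₂ e₁)

/-- Equality of naturals. -/
abbrev Test.natEq (e₁ e₂ : NatExpr) : Test := .and (.natLe e₁ e₂) (.natLe e₂ e₁)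

/-! ### The cells that a program may change -/

namespace Program

/-- Some assignment to naturals is to the array `a`. -/
def writesNat (a : ℕ) : Program → Bool
  | skip => false
  | setNat a' _ _ => a == a'
  | setReal _ _ _ => false
  | seq p q => p.writesNat a || q.writesNat a
  | ite _ p q => p.writesNat a || q.writesNat a
  | .while _ p => p.writesNat a

/-- All assignments to reals are to fixed cells of the array `0`. -/
def realSafe : Program → Bool
  | skip => true
  | setNat _ _ _ => true
  | setReal 0 (.const _) _ => true
  | setReal _ _ _ => false
  | seq p q => p.realSafe && q.realSafe
  | ite _ p q => p.realSafe && q.realSafe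
  | .while _ p => p.realSafe

/-- Some assignment to reals is to a fixed cell `c`. -/
def writesCell (c : ℕ) : Program → Bool
  | skip => false
  | setNat _ _ _ => false
  | setReal _ (.const c') _ => c == c'
  | setReal _ _ _ => false
  | seq p q => p.writesCell c || q.writesCell c
  | ite _ p q => p.writesCell c || q.writesCell c
  | .while _ p => p.writesCell c

/-- Let the variable `x` run through the numbers below the value of `e`. -/
def forRange (x : ℕ) (e : NatExpr) (body : Program) : Program :=
  .seq (.setNat x (.const 0) (.const 0))
    (.while (.natLt (.var x) e) (.seq body (.setNat x (.const 0) (.add (.var x) (.const 1)))))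

end Program

/-- Sequential composition of programs. -/
infixr:60 " ⨟ " => Program.seq

/-- The memories `s` and `s'` agree on everything that `p` does not assign to. -/
structure Frame (p : Program) (s s' : Memory) : Prop where
  nat : ∀ a, p.writesNat a = false → s'.nat a = s.nat a
  real : p.realSafe = true → ∀ a, s'.real (a + 1) = s.real (a + 1)
  cell : p.realSafe = true → ∀ c, p.writesCell c = false → s'.real 0 c = s.real 0 c

theorem Frame.refl (p : Program) (s : Memory) : Frame p s s :=
  ⟨fun _ _ => rfl, fun _ _ => rfl, fun _ _ _ => rfl⟩

theorem Frame.trans {p : Program} {s₁ s₂ s₃ : Memory} (h : Frame p s₁ s₂) (h' : Frame p s₂ s₃) :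
    Frame p s₁ s₃ :=
  ⟨fun a ha => (h'.nat a ha).trans (h.nat a ha), fun hp a => (h'.real hp a).trans (h.real hp a),
    fun hp c hc => (h'.cell hp c hc).trans (h.cell hp c hc)⟩

theorem Frame.mono {p q : Program} {s s' : Memory} (h : Frame p s s')
    (h₁ : ∀ a, q.writesNat a = false → p.writesNat a = false)
    (h₂ : q.realSafe = true → p.realSafe = true)
    (h₃ : ∀ c, q.writesCell c = false → p.writesCell c = false) : Frame q s s' :=
  ⟨fun a ha => h.nat a (h₁ a ha), fun hq => h.real (h₂ hq),
    fun hq c hc => h.cell (h₂ hq) c (h₃ c hc)⟩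

/-- What a program may change is read off its syntax by Boolean functions, so for a concrete program
and array preservation is mostly proved by `rfl`, and postconditions need not list what is
unchanged. -/
theorem Exec.frame {p : Program} {s s' : Memory} {t : ℕ} (h : Exec p s s' t) : Frame p s s' := by
  induction h with
  | skip s => exact .refl _ _
  | setNat s a e₁ e₂ =>
    exact ⟨fun a' ha => by simp_all [Program.writesNat], fun _ _ => rfl, fun _ _ _ => rfl⟩
  | setReal s a e₁ e₂ =>
    refine ⟨fun _ _ => rfl, fun hp a' => ?_, fun hp c hc => ?_⟩
    · unfold Program.realSafe at hp
      split at hp <;> simp_all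
    · unfold Program.realSafe at hp
      split at hp <;> simp_all [Program.writesCell]
  | seq h₁ h₂ ih₁ ih₂ =>
    refine (ih₁.mono ?_ ?_ ?_).trans (ih₂.mono ?_ ?_ ?_) <;>
      simp +contextual [Program.writesNat, Program.realSafe, Program.writesCell]
  | ite_true hb h ih =>
    refine ih.mono ?_ ?_ ?_ <;>
      simp +contextual [Program.writesNat, Program.realSafe, Program.writesCell]
  | ite_false hb h ih =>
    refine ih.mono ?_ ?_ ?_ <;>
      simp +contextual [Program.writesNat, Program.realSafe, Program.writesCell]
  | while_true hb h₁ h₂ ih₁ ih₂ =>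
    refine (ih₁.mono ?_ ?_ ?_).trans ih₂ <;>
      simp +contextual [Program.writesNat, Program.realSafe, Program.writesCell]
  | while_false hb => exact .refl _ _

/-! ### Total correctness with time bounds -/

/-- An upper bound for the running time if every execution of a loop has at most `N` rounds. -/
def Program.timeBound (N : ℕ) : Program → ℕ
  | skip => 1
  | setNat _ e₁ e₂ => e₁.cost + e₂.cost + 1
  | setReal _ e₁ e₂ => e₁.cost + e₂.cost + 1
  | seq p q => p.timeBound N + q.timeBound N
  | ite b p q => b.cost + (p.timeBound N + q.timeBound N)
  | .while b p => (N + 1) * (b.cost + p.timeBound N)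

/-- Each enclosing loop contributes one factor `N + 1`, and the nesting depth of a fixed program is
constant. -/
theorem Program.polyBdd_timeBound (p : Program) : PolyBdd fun N => p.timeBound N := by
  induction p <;> simp only [timeBound] <;> fun_prop

theorem Program.timeBound_mono (p : Program) : Monotone fun N => p.timeBound N := by
  intro N N' h
  induction p <;> simp only [timeBound] <;> gcongr

/-- Started on `s`, the program `p` halts on a memory that satisfies `Q`, within the time that it
takes if every execution of a loop has at most `N` rounds. -/
def Run (N : ℕ) (p : Program) (s : Memory) (Q : Memory → Prop) : Prop :=
  ∃ s' t, Exec p s s' t ∧ t ≤ p.timeBound N ∧ Q s'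

namespace Run

variable {N : ℕ} {p q : Program} {s : Memory} {Q R : Memory → Prop}

theorem imp (h : Run N p s Q) (hQR : ∀ s', Frame p s s' → Q s' → R s') : Run N p s R := by
  obtain ⟨s', t, h, ht, hQ⟩ := h
  exact ⟨s', t, h, ht, hQR s' h.frame hQ⟩

theorem mono {N' : ℕ} (h : Run N p s Q) (hN : N ≤ N') : Run N' p s Q := by
  obtain ⟨s', t, h, ht, hQ⟩ := h
  exact ⟨s', t, h, ht.trans (p.timeBound_mono hN), hQ⟩

theorem skip (h : Q s) : Run N .skip s Q := ⟨s, 1, .skip s, le_rfl, h⟩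

theorem setNat {a : ℕ} {e₁ e₂ : NatExpr} (h : Q (s.setNat a (e₁.eval s) (e₂.eval s))) :
    Run N (.setNat a e₁ e₂) s Q := ⟨_, _, .setNat s a e₁ e₂, le_rfl, h⟩

theorem setReal {a : ℕ} {e₁ : NatExpr} {e₂ : RealExpr}
    (h : Q (s.setReal a (e₁.eval s) (e₂.eval s))) :
    Run N (.setReal a e₁ e₂) s Q := ⟨_, _, .setReal s a e₁ e₂, le_rfl, h⟩

theorem seq (h : Run N p s R) (h' : ∀ s', Frame p s s' → R s' → Run N q s' Q) :
    Run N (p ⨟ q) s Q := by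
  obtain ⟨s', t, h, ht, hR⟩ := h
  obtain ⟨s'', t', h', ht', hQ⟩ := h' s' h.frame hR
  exact ⟨s'', t + t', .seq h h', add_le_add ht ht', hQ⟩

theorem setNat_seq {a : ℕ} {e₁ e₂ : NatExpr}
    (h : Run N q (s.setNat a (e₁.eval s) (e₂.eval s)) Q) : Run N (.setNat a e₁ e₂ ⨟ q) s Q :=
  .seq (.setNat (Q := (· = s.setNat a (e₁.eval s) (e₂.eval s))) rfl) fun _ _ hs => hs ▸ h

theorem setReal_seq {a : ℕ} {e₁ : NatExpr} {e₂ : RealExpr}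
    (h : Run N q (s.setReal a (e₁.eval s) (e₂.eval s)) Q) : Run N (.setReal a e₁ e₂ ⨟ q) s Q :=
  .seq (.setReal (Q := (· = s.setReal a (e₁.eval s) (e₂.eval s))) rfl) fun _ _ hs => hs ▸ h

theorem ite {b : Test} (h₁ : b.Holds s → Run N p s Q) (h₂ : ¬ b.Holds s → Run N q s Q) :
    Run N (.ite b p q) s Q := by
  by_cases hb : b.Holds s
  · obtain ⟨s', t, h, ht, hQ⟩ := h₁ hb
    exact ⟨s', _, .ite_true hb h, by simp only [Program.timeBound]; omega, hQ⟩
  · obtain ⟨s', t, h, ht, hQ⟩ := h₂ hb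
    exact ⟨s', _, .ite_false hb h, by simp only [Program.timeBound]; omega, hQ⟩

/-- The index of the invariant counts completed rounds. `M` is only a cap: the loop may stop
earlier, but the invariant at `M` must refute the guard. -/
theorem while_le {b : Test} (Inv : ℕ → Memory → Prop) (M : ℕ) (hMN : M ≤ N) (h0 : Inv 0 s)
    (hM : ∀ s', Frame (.while b p) s s' → Inv M s' → ¬ b.Holds s')
    (hstep : ∀ i s', i < M → Frame (.while b p) s s' → Inv i s' → b.Holds s' →
      Run N p s' (Inv (i + 1)))
    (hQ : ∀ i s', i ≤ M → Frame (.while b p) s s' → Inv i s' → ¬ b.Holds s' → Q s') :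
    Run N (.while b p) s Q := by
  -- The induction is on the number `j` of rounds that are still allowed.
  have key : ∀ j i s', i + j = M → Frame (.while b p) s s' → Inv i s' →
      ∃ s'' t, Exec (.while b p) s' s'' t ∧ t ≤ (j + 1) * (b.cost + p.timeBound N) ∧ Q s'' := by
    intro j
    induction j with
    | zero =>
      intro i s' hi hf hs
      obtain rfl : i = M := by omega
      exact ⟨s', _, .while_false (hM s' hf hs), by omega, hQ i s' le_rfl hf hs (hM s' hf hs)⟩
    | succ j ih =>
      intro i s' hi hf hs
      by_cases hb : b.Holds s'
      · obtain ⟨s₁, t₁, h₁, ht₁, hs₁⟩ := hstep i s' (by omega) hf hs hb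
        have hf₁ : Frame (.while b p) s s₁ := hf.trans (h₁.frame.mono
          (by simp +contextual [Program.writesNat]) (by simp +contextual [Program.realSafe])
          (by simp +contextual [Program.writesCell]))
        obtain ⟨s₂, t₂, h₂, ht₂, hs₂⟩ := ih (i + 1) s₁ (by omega) hf₁ hs₁
        refine ⟨s₂, _, .while_true hb h₁ h₂, ?_, hs₂⟩
        calc b.cost + t₁ + t₂ ≤ b.cost + p.timeBound N + (j + 1) * (b.cost + p.timeBound N) := by
              omega
          _ = _ := by ring
      · refine ⟨s', _, .while_false hb, ?_, hQ i s' (by omega) hf hs hb⟩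
        calc b.cost ≤ 1 * (b.cost + p.timeBound N) := by omega
          _ ≤ _ := by gcongr; omega
  obtain ⟨s', t, h, ht, hQ⟩ := key M 0 s (by omega) (.refl _ _) h0
  exact ⟨s', t, h, ht.trans (by simp only [Program.timeBound]; gcongr), hQ⟩

/-- The bound `e` is evaluated again in every round, so its value has to be stable under everything
that the loop may change. -/
theorem forRange {x : ℕ} {e : NatExpr} (Inv : ℕ → Memory → Prop) (M : ℕ) (hMN : M ≤ N)
    (hx : p.writesNat x = false) (he : ∀ s', Frame (.forRange x e p) s s' → e.eval s' = M)
    (h0 : Inv 0 (s.setNat x 0 0))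
    (hstep : ∀ i s', i < M → Frame (.forRange x e p) s s' → s'.nat x 0 = i → Inv i s' →
      Run N p s' fun s'' => Inv (i + 1) (s''.setNat x 0 (i + 1))) :
    Run N (.forRange x e p) s (Inv M) := by
  have hsub : ∀ s', Frame (.while (.natLt (.var x) e)
      (p ⨟ .setNat x (.const 0) (.add (.var x) (.const 1)))) (s.setNat x 0 0) s' →
      Frame (.forRange x e p) s s' := fun s' hs' =>
    Frame.trans (s₂ := s.setNat x 0 0)
      ((Exec.setNat s x (.const 0) (.const 0)).frame.mono
        (by simp +contextual [Program.writesNat, Program.forRange])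
        (by simp +contextual [Program.realSafe])
        (by simp +contextual [Program.writesCell]))
      (hs'.mono (by simp +contextual [Program.writesNat, Program.forRange])
        (by simp +contextual [Program.realSafe, Program.forRange])
        (by simp +contextual [Program.writesCell, Program.forRange]))
  refine setNat_seq (while_le (fun i s' => s'.nat x 0 = i ∧ Inv i s') M hMN ?_ ?_ ?_ ?_)
  · simpa using h0
  · rintro s' hf ⟨hi, -⟩
    simp [he s' (hsub s' hf), hi]
  · rintro i s' hiM hf ⟨hi, hs'⟩ -
    refine seq (hstep i s' hiM (hsub s' hf) hi hs') fun s'' hf' hs'' => setNat ?_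
    have : s''.nat x 0 = i := by rw [hf'.nat x hx, hi]
    simpa [this] using hs''
  · rintro i s' hiM hf ⟨hi, hs'⟩ hb
    simp only [Test.Holds, NatExpr.eval, he s' (hsub s' hf), hi] at hb
    obtain rfl : i = M := by omega
    exact hs'

end Run

end RAM

/-! ### Arithmetic by repeated addition, sums and counts -/

namespace RAM

open NatExpr Program

/-! ### Products and powers -/

/-- Store the product of two naturals in the variable `20`. -/
def mulProg (e₁ e₂ : NatExpr) : Program :=
  .setNat 20 (.const 0) (.const 0) ⨟
  .forRange 21 e₂ (.setNat 20 (.const 0) (.add (.var 20) e₁))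

/-- The machine cannot multiply, so `a` is added `b` times; only the second factor has to be bounded
by `N`. Both operands are evaluated repeatedly, hence the hypotheses over all framed memories. -/
theorem run_mulProg {N a b : ℕ} {s : Memory} (e₁ e₂ : NatExpr) (hb : b ≤ N)
    (h₁ : ∀ s', Frame (mulProg e₁ e₂) s s' → e₁.eval s' = a)
    (h₂ : ∀ s', Frame (mulProg e₁ e₂) s s' → e₂.eval s' = b) :
    Run N (mulProg e₁ e₂) s fun s' => s'.nat 20 0 = a * b := by
  have hfr : ∀ s', Frame (.forRange 21 e₂ (.setNat 20 (.const 0) (.add (.var 20) e₁)))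
      (s.setNat 20 0 0) s' → Frame (mulProg e₁ e₂) s s' := fun s' h =>
    Frame.trans ((Exec.setNat s 20 (.const 0) (.const 0)).frame.mono
      (by simp +contextual [mulProg, writesNat]) (by simp [realSafe])
      (by simp [writesCell])) (h.mono (by simp +contextual [mulProg, writesNat])
      (by simp [mulProg, realSafe]) (by simp [mulProg, writesCell]))
  refine Run.setNat_seq ((Run.forRange (fun i s' => s'.nat 20 0 = a * i) b hb rfl
    (fun s' hs' => h₂ s' (hfr s' hs')) (by simp) ?_))
  intro i s' hi hf hx hs'
  refine Run.setNat ?_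
  simp [hs', h₁ s' (hfr s' hf), mul_add]

/-- Fill the array `arr` with the powers of `e` with exponents up to `c`. -/
def powProg (arr : ℕ) (e : NatExpr) (c : ℕ) : Program :=
  .setNat arr (.const 0) (.const 1) ⨟
  .forRange 22 (.const c) (mulProg (.read arr (.var 22)) e ⨟
    .setNat arr (.add (.var 22) (.const 1)) (.var 20))

theorem run_powProg {N b c : ℕ} {s : Memory} (arr : ℕ) (e : NatExpr)
    (harr : 22 < arr ∨ arr < 20) (hc : c ≤ N) (hb : b ≤ N)
    (he : ∀ s', Frame (powProg arr e c) s s' → e.eval s' = b) :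
    Run N (powProg arr e c) s fun s' => ∀ j ≤ c, s'.nat arr j = b ^ j := by
  have h20 : arr ≠ 20 := by omega
  have h21 : arr ≠ 21 := by omega
  have h22 : arr ≠ 22 := by omega
  refine Run.setNat_seq ((Run.forRange (fun i s' => ∀ j ≤ i, s'.nat arr j = b ^ j) c hc
    (by simp [writesNat, mulProg, forRange, h22.symm]) (by simp) ?_ ?_))
  · simp [h22]
  · intro i s' hi hf hx hs'
    have hfr : ∀ s'', Frame (mulProg (.read arr (.var 22)) e) s' s'' →
        Frame (powProg arr e c) s s'' := fun s'' hs'' => by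
      refine Frame.trans ((Exec.setNat s arr (.const 0) (.const 1)).frame.mono
        (by simp +contextual [powProg, writesNat]) (by simp [realSafe])
        (by simp [writesCell])) ((hf.trans (hs''.mono ?_ ?_ ?_)).mono ?_ ?_ ?_) <;>
        simp +contextual [powProg, writesNat, mulProg, forRange, realSafe, writesCell]
    have hfa : ∀ s'', Frame (mulProg (.read arr (.var 22)) e) s' s'' →
        s''.nat arr = s'.nat arr ∧ s''.nat 22 = s'.nat 22 := fun s'' hs'' =>
      ⟨hs''.nat arr (by simp [writesNat, mulProg, forRange, h20, h21]), hs''.nat 22 rfl⟩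
    refine Run.seq (run_mulProg (a := b ^ i) _ _ hb ?_ fun s'' hs'' => he s'' (hfr s'' hs'')) ?_
    · intro s'' hs''
      simp [hfa s'' hs'', hx, hs']
    · intro s'' hs'' hr
      obtain ⟨h1, h2⟩ := hfa s'' hs''
      refine Run.setNat ?_
      intro j hj
      rcases Nat.lt_or_ge i j with hij | hij
      · obtain rfl : j = i + 1 := by omega
        simp [h22, h2, hx, hr, pow_succ]
      · have : j ≠ i + 1 := by omega
        simp [h22, h2, hx, h1, hs' j hij, this]

/-! ### The inverse of the accuracy -/

/-- Store in the variable `5` the least positive `k` with `1 ≤ k * ε`. -/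
def invProg : Program :=
  .setNat 5 (.const 0) (.const 1) ⨟
  .setReal 0 (.const 1) (.read 0 (.const 0)) ⨟
  .while (.not (.realLe (.const 1) (.read 0 (.const 1))))
    (.setNat 5 (.const 0) (.add (.var 5) (.const 1)) ⨟
      .setReal 0 (.const 1) (.add (.read 0 (.const 1)) (.read 0 (.const 0))))

/-- In place of a division, `ε` is added to itself until the sum reaches `1`. The counter starts at
`1`, which is the source of the bound `N + 1`. -/
theorem run_invProg {N : ℕ} {s : Memory} (hs : 0 ≤ s.real 0 0)
    (hN : 1 ≤ N * s.real 0 0) :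
    Run N invProg s fun s' =>
      1 ≤ s'.nat 5 0 ∧ 1 ≤ s'.nat 5 0 * s.real 0 0 ∧ s'.nat 5 0 ≤ N + 1 := by
  refine Run.setNat_seq (Run.setReal_seq (Run.while_le (fun i s' => s'.nat 5 0 = i + 1 ∧
    s'.real 0 1 = (i + 1) * s.real 0 0) N le_rfl ?_ ?_ ?_ ?_))
  · simp
  · rintro s' hf ⟨-, h2⟩
    simp only [Test.Holds, RealExpr.eval, NatExpr.eval, h2]
    push Not
    push_cast
    linarith
  · rintro i s' hi hf ⟨h1, h2⟩ -
    have h0 : s'.real 0 0 = s.real 0 0 := by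
      rw [hf.cell rfl 0 rfl]; simp
    refine Run.setNat_seq (Run.setReal ?_)
    simp [h1, h2, h0]; ring
  · rintro i s' hi hf ⟨h1, h2⟩ hb
    simp only [Test.Holds, RealExpr.eval, NatExpr.eval, h2, not_not] at hb
    refine ⟨by omega, ?_, by omega⟩
    rw [h1]
    push_cast at hb ⊢
    exact hb

/-! ### Sums and counts over the items with a given label -/

/-- The value of the bundle of the items with label `k`. -/
noncomputable def bundleSum (m : ℕ) (A : ℕ → ℕ) (u : ℕ → ℝ) (k : ℕ) : ℝ :=
  ∑ g ∈ range m with A g = k, u g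

/-- The number of items of category `j` in the bundle of the items with label `k`. -/
def bundleCount (m : ℕ) (A c : ℕ → ℕ) (k j : ℕ) : ℕ := #{g ∈ range m | A g = k ∧ c g = j}

theorem bundleSum_succ (m : ℕ) (A : ℕ → ℕ) (u : ℕ → ℝ) (k : ℕ) :
    bundleSum (m + 1) A u k = bundleSum m A u k + if A m = k then u m else 0 := by
  simp only [bundleSum, sum_filter, sum_range_succ]

theorem bundleCount_succ (m : ℕ) (A c : ℕ → ℕ) (k j : ℕ) :
    bundleCount (m + 1) A c k j =
      bundleCount m A c k j + if A m = k ∧ c m = j then 1 else 0 := by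
  simp only [bundleCount, card_filter, sum_range_succ]

/-- Compute the value, in terms of the array `U`, of the bundle given by the array `La` of labels
and the label in the variable `24`. -/
def sumProg (La U : ℕ) : Program :=
  .setReal 0 (.const 1) (.const 0) ⨟
  .forRange 25 (.var 0) (.ite (.natEq (.read La (.var 25)) (.var 24))
    (.setReal 0 (.const 1) (.add (.read 0 (.const 1)) (.read U (.var 25)))) .skip)

theorem run_sumProg {N : ℕ} {s : Memory} (La U : ℕ) (hLa : La ≠ 25) (hN : s.nat 0 0 ≤ N) :
    Run N (sumProg La (U + 1)) s fun s' =>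
      s'.real 0 1 = bundleSum (s.nat 0 0) (s.nat La) (s.real (U + 1)) (s.nat 24 0) := by
  refine Run.setReal_seq (Run.forRange (fun i s' => s'.real 0 1 =
    bundleSum i (s.nat La) (s.real (U + 1)) (s.nat 24 0)) (s.nat 0 0) hN rfl ?_ ?_ ?_)
  · intro s' hf
    simp [hf.nat 0 rfl]
  · simp [bundleSum]
  · intro i s' hi hf hx hs'
    have h1 : s'.nat La = s.nat La := by
      rw [hf.nat La (by simp +contextual [writesNat, Program.forRange, hLa])]; rfl
    have h2 : s'.nat 24 = s.nat 24 := by rw [hf.nat 24 rfl]; rfl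
    have h3 : s'.real (U + 1) = s.real (U + 1) := by
      rw [hf.real rfl]; simp
    refine Run.ite (fun hb => Run.setReal ?_) fun hb => Run.skip ?_ <;>
      simp only [Test.Holds, NatExpr.eval, h1, h2, hx, ← le_antisymm_iff] at hb <;>
      simp [bundleSum_succ, hb, hs', hx, h3]

/-- Store in the variable `16` the number of items of the category in the variable `22` in the
bundle given by the array `15` of labels and the label in the variable `24`. -/
def countProg : Program :=
  .setNat 16 (.const 0) (.const 0) ⨟
  .forRange 25 (.var 0) (.ite (.and (.natEq (.read 15 (.var 25)) (.var 24))
      (.natEq (.read 1 (.var 25)) (.var 22)))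
    (.setNat 16 (.const 0) (.add (.var 16) (.const 1))) .skip)

theorem run_countProg {N : ℕ} {s : Memory} (hN : s.nat 0 0 ≤ N) : Run N countProg s fun s' =>
      s'.nat 16 0 = bundleCount (s.nat 0 0) (s.nat 15) (s.nat 1) (s.nat 24 0) (s.nat 22 0) := by
  refine Run.setNat_seq (Run.forRange (fun i s' => s'.nat 16 0 =
    bundleCount i (s.nat 15) (s.nat 1) (s.nat 24 0) (s.nat 22 0)) (s.nat 0 0) hN rfl
    ?_ ?_ ?_)
  · intro s' hf
    simp [hf.nat 0 rfl]
  · simp [bundleCount]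
  · intro i s' hi hf hx hs'
    have h1 : s'.nat 15 = s.nat 15 := by rw [hf.nat 15 rfl]; simp
    have h2 : s'.nat 24 = s.nat 24 := by rw [hf.nat 24 rfl]; simp
    have h3 : s'.nat 22 = s.nat 22 := by rw [hf.nat 22 rfl]; simp
    have h4 : s'.nat 1 = s.nat 1 := by rw [hf.nat 1 rfl]; simp
    refine Run.ite (fun hb => Run.setNat ?_) fun hb => Run.skip ?_ <;>
      simp only [Test.Holds, NatExpr.eval, h1, h2, h3, h4, hx, ← le_antisymm_iff] at hb <;>
      simp [bundleCount_succ, hb, hs']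

end RAM

/-! ### Parameters, rounded values and item weights -/

namespace RAM

open NatExpr Program

/-! ### Parameters -/

/-- The base of the positional system in which the states of the dynamic program are written. -/
def digitBase (m k : ℕ) : ℕ := m * (m * (m * k) + 1) + 1

/-- The number of cells of the table of the dynamic program. -/
def tableSize (n ℓ m k : ℕ) : ℕ := (m + 1) * (digitBase m k ^ (ℓ + 1)) ^ n

/-- Compute the parameters of the algorithm. -/
def setupProg (n ℓ : ℕ) : Program :=
  invProg ⨟
  mulProg (.var 0) (.var 5) ⨟ .setNat 6 (.const 0) (.var 20) ⨟
  mulProg (.var 0) (.var 6) ⨟ .setNat 7 (.const 0) (.var 20) ⨟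
  mulProg (.var 0) (.add (.var 7) (.const 1)) ⨟ .setNat 8 (.const 0) (.add (.var 20) (.const 1)) ⨟
  powProg 9 (.var 8) (ℓ + 1) ⨟ powProg 10 (.read 9 (.const (ℓ + 1))) n ⨟
  mulProg (.add (.var 0) (.const 1)) (.read 10 (.const n)) ⨟ .setNat 11 (.const 0) (.var 20)

/-- The parameters of the algorithm have been stored. -/
structure Params (n ℓ k : ℕ) (s : Memory) : Prop where
  scale : s.nat 6 0 = s.nat 0 0 * k
  cap : s.nat 7 0 = s.nat 0 0 * (s.nat 0 0 * k)
  pow : ∀ j ≤ ℓ + 1, s.nat 9 j = digitBase (s.nat 0 0) k ^ j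
  pow_pow : ∀ j ≤ n, s.nat 10 j = (digitBase (s.nat 0 0) k ^ (ℓ + 1)) ^ j
  size : s.nat 11 0 = tableSize n ℓ (s.nat 0 0) k

theorem Params.congr {n ℓ k : ℕ} {s s' : Memory} (h : Params n ℓ k s)
    (h' : ∀ a ∈ [0, 6, 7, 9, 10, 11], s'.nat a = s.nat a) : Params n ℓ k s' := by
  simp only [List.mem_cons, List.not_mem_nil, or_false, forall_eq_or_imp, forall_eq] at h'
  obtain ⟨h0, h6, h7, h9, h10, h11⟩ := h'
  constructor
  · rw [h6, h0, h.scale]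
  · rw [h7, h0, h.cap]
  · rw [h9, h0]; exact h.pow
  · rw [h10, h0]; exact h.pow_pow
  · rw [h11, h0, h.size]

theorem digitBase_pos (m k : ℕ) : 0 < digitBase m k := by unfold digitBase; omega

theorem pow_le_tableSize {n ℓ m k j : ℕ} (hj : j ≤ n) :
    (digitBase m k ^ (ℓ + 1)) ^ j ≤ tableSize n ℓ m k :=
  (Nat.pow_le_pow_right (pow_pos (digitBase_pos _ _) _) hj).trans
    (Nat.le_mul_of_pos_left _ (by omega))

theorem digitBase_le_tableSize {n ℓ m k : ℕ} (hn : 0 < n) : digitBase m k ≤ tableSize n ℓ m k :=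
  (Nat.le_self_pow (Nat.succ_ne_zero ℓ) _).trans
    (by simpa using pow_le_tableSize (ℓ := ℓ) (m := m) (k := k) (j := 1) hn)

theorem lt_tableSize (n ℓ m k : ℕ) : m < tableSize n ℓ m k :=
  lt_of_lt_of_le (Nat.lt_succ_self m)
    (Nat.le_mul_of_pos_right _ (pow_pos (pow_pos (digitBase_pos _ _) _) _))

theorem cap_le_digitBase (m k : ℕ) : m * (m * k) ≤ digitBase m k := by
  unfold digitBase
  rcases Nat.eq_zero_or_pos m with rfl | hm
  · simp
  · nlinarith [Nat.zero_le (m * (m * k)), Nat.le_mul_of_pos_left (m * (m * k) + 1) hm]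

/-- The value of `k` is only found at run time, so `N` has to dominate the table sizes for all `k`
up to `N₀ + 1`. -/
theorem run_setupProg {n ℓ N₀ N : ℕ} {s : Memory} (hn : 0 < n) (hs : 0 ≤ s.real 0 0)
    (hN₀ : 1 ≤ N₀ * s.real 0 0)
    (hN : ∀ k ≤ N₀ + 1, tableSize n ℓ (s.nat 0 0) k + k + n + ℓ + 1 ≤ N) :
    Run N (setupProg n ℓ) s fun s' => ∃ k : ℕ, 1 ≤ k ∧ 1 ≤ k * s.real 0 0 ∧ k ≤ N₀ + 1 ∧
      Params n ℓ k s' := by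
  have h0 : N₀ ≤ N := by have := hN N₀ (by omega); omega
  refine Run.seq ((run_invProg hs hN₀).mono h0) ?_
  rintro s₁ hf₁ ⟨hk₁, hk₂, hk₃⟩
  have hf₁0 := hf₁.nat 0 rfl
  have hNk := hN _ hk₃
  set m := s.nat 0 0 with hm
  set k := s₁.nat 5 0 with hk
  have hbase := digitBase_le_tableSize (ℓ := ℓ) (m := m) (k := k) hn
  have hcap := cap_le_digitBase m k
  have hmb : m * k ≤ m * (m * k) := by
    rcases Nat.eq_zero_or_pos m with h | h
    · simp [h]
    · exact Nat.le_mul_of_pos_left _ h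
  have hcap' : m * (m * k) + 1 ≤ tableSize n ℓ m k + 1 := by omega
  refine Run.seq (run_mulProg (a := m) (b := k) _ _ (by omega)
    (fun s' hs' => by simp [hs'.nat 0 rfl, hf₁0, hm])
    fun s' hs' => by simp [hs'.nat 5 rfl, hk]) fun s₂ hf₂ h₂ => Run.setNat_seq ?_
  have hf₂0 := hf₂.nat 0 rfl
  set s₂' := s₂.setNat 6 _ _ with hs₂'
  have h₂0 : s₂'.nat 0 0 = m := by simp [hs₂', hf₂0, hf₁0, hm]
  have h₂6 : s₂'.nat 6 0 = m * k := by simp [hs₂', h₂]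
  clear_value s₂'
  refine Run.seq (run_mulProg (a := m) (b := m * k) _ _ (by omega)
    (fun s' hs' => by simp [hs'.nat 0 rfl, h₂0])
    fun s' hs' => by simp [hs'.nat 6 rfl, h₂6]) fun s₃ hf₃ h₃ => Run.setNat_seq ?_
  have hf₃0 := hf₃.nat 0 rfl
  have hf₃6 := hf₃.nat 6 rfl
  set s₃' := s₃.setNat 7 _ _ with hs₃'
  have h₃0 : s₃'.nat 0 0 = m := by simp [hs₃', hf₃0, h₂0]
  have h₃6 : s₃'.nat 6 0 = m * k := by simp [hs₃', hf₃6, h₂6]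
  have h₃7 : s₃'.nat 7 0 = m * (m * k) := by simp [hs₃', h₃]
  clear_value s₃'
  refine Run.seq (run_mulProg (a := m) (b := m * (m * k) + 1) _ _ (by omega)
    (fun s' hs' => by simp [hs'.nat 0 rfl, h₃0])
    fun s' hs' => by simp [hs'.nat 7 rfl, h₃7]) fun s₄ hf₄ h₄ => Run.setNat_seq ?_
  have hf₄0 := hf₄.nat 0 rfl
  have hf₄6 := hf₄.nat 6 rfl
  have hf₄7 := hf₄.nat 7 rfl
  set s₄' := s₄.setNat 8 _ _ with hs₄'
  have h₄0 : s₄'.nat 0 0 = m := by simp [hs₄', hf₄0, h₃0]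
  have h₄6 : s₄'.nat 6 0 = m * k := by simp [hs₄', hf₄6, h₃6]
  have h₄7 : s₄'.nat 7 0 = m * (m * k) := by simp [hs₄', hf₄7, h₃7]
  have h₄8 : s₄'.nat 8 0 = digitBase m k := by simp [hs₄', h₄, digitBase]
  clear_value s₄'
  refine Run.seq (run_powProg (b := digitBase m k) 9 _ (by omega) (by omega) (by omega)
    fun s' hs' => by simp [hs'.nat 8 rfl, h₄8]) fun s₅ hf₅ h₅ => ?_
  refine Run.seq (run_powProg (b := digitBase m k ^ (ℓ + 1)) 10 _ (by omega) (by omega)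
    (by have := pow_le_tableSize (n := n) (ℓ := ℓ) (m := m) (k := k) (j := 1) (by omega)
        rw [pow_one] at this; omega)
    fun s' hs' => by simp [hs'.nat 9 rfl, h₅]) fun s₆ hf₆ h₆ => ?_
  refine Run.seq (run_mulProg (a := m + 1) (b := (digitBase m k ^ (ℓ + 1)) ^ n) _ _
    (by have := pow_le_tableSize (n := n) (ℓ := ℓ) (m := m) (k := k) (j := n) (by omega)
        omega)
    (fun s' hs' => by simp [hs'.nat 0 rfl, hf₆.nat 0 rfl, hf₅.nat 0 rfl, h₄0])
    fun s' hs' => by simp [hs'.nat 10 rfl, h₆]) fun s₇ hf₇ h₇ => Run.setNat ?_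
  have e0 : s₇.nat 0 0 = m := by rw [hf₇.nat 0 rfl, hf₆.nat 0 rfl, hf₅.nat 0 rfl, h₄0]
  have e6 : s₇.nat 6 0 = m * k := by rw [hf₇.nat 6 rfl, hf₆.nat 6 rfl, hf₅.nat 6 rfl, h₄6]
  have e7 : s₇.nat 7 0 = m * (m * k) := by
    rw [hf₇.nat 7 rfl, hf₆.nat 7 rfl, hf₅.nat 7 rfl, h₄7]
  have e9 : s₇.nat 9 = s₅.nat 9 := by rw [hf₇.nat 9 rfl, hf₆.nat 9 rfl]
  have e10 : s₇.nat 10 = s₆.nat 10 := by rw [hf₇.nat 10 rfl]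
  refine ⟨k, hk₁, hk₂, hk₃, ?_, ?_, ?_, ?_, ?_⟩
  · simp [e0, e6]
  · simp [e0, e7]
  · simpa [e0, e9] using h₅
  · simpa [e0, e10] using h₆
  · simp [e0, h₇, tableSize]

/-! ### Rounded values and weights -/

/-- The number `r` is the quotient `Q * x / a`, rounded down and capped at `K`. -/
structure IsRound (Q K : ℕ) (a x : ℝ) (r : ℕ) : Prop where
  le_cap : r ≤ K
  le_quot : r * a ≤ Q * x
  quot_lt : r = K ∨ Q * x < (r + 1) * a

/-- Store the absolute value of a real in the cell `c`. -/
def absProg (c : ℕ) (e : RealExpr) : Program :=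
  .ite (.realLe (.const 0) e) (.setReal 0 (.const c) e) (.setReal 0 (.const c) (.sub (.const 0) e))

theorem run_absProg {N : ℕ} {s : Memory} (c : ℕ) (e : RealExpr) :
    Run N (absProg c e) s fun s' => s'.real 0 c = |e.eval s| ∧ s'.nat = s.nat := by
  refine Run.ite (fun h => Run.setReal ?_) fun h => Run.setReal ?_
  · simp only [Test.Holds, RealExpr.eval, Nat.cast_zero] at h
    simp [abs_of_nonneg h]
  · simp only [Test.Holds, RealExpr.eval, Nat.cast_zero, not_le] at h
    simp [abs_of_neg h]

/-- Store in the variable `26` the quotient `Q * x / a`, rounded down and capped at `K`, where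
`Q` and `K` are in the variables `6` and `7`, and `a` and `x` in the cells `3` and `6`. -/
def roundProg : Program :=
  .setReal 0 (.const 1) (.const 0) ⨟
  .forRange 27 (.var 6)
    (.setReal 0 (.const 1) (.add (.read 0 (.const 1)) (.read 0 (.const 6)))) ⨟
  .setReal 0 (.const 2) (.read 0 (.const 3)) ⨟
  .setNat 26 (.const 0) (.const 0) ⨟
  .forRange 27 (.var 7) (.ite (.realLe (.read 0 (.const 2)) (.read 0 (.const 1)))
    (.setNat 26 (.const 0) (.add (.var 26) (.const 1)) ⨟
      .setReal 0 (.const 2) (.add (.read 0 (.const 2)) (.read 0 (.const 3)))) .skip)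

/-- The quotient counts how many multiples of `a` fit below the accumulated product `Q * x`; the cap
`K` limits the number of comparisons. -/
theorem run_roundProg {N : ℕ} {s : Memory} (hQ : s.nat 6 0 ≤ N) (hK : s.nat 7 0 ≤ N)
    (hx : 0 ≤ s.real 0 6) :
    Run N roundProg s fun s' =>
      IsRound (s.nat 6 0) (s.nat 7 0) (s.real 0 3) (s.real 0 6) (s'.nat 26 0) := by
  refine Run.setReal_seq (Run.seq (Run.forRange (fun i s' => s'.real 0 1 = i * s.real 0 6)
    (s.nat 6 0) hQ rfl ?_ (by simp) ?_) ?_)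
  · intro s' hf
    simp [hf.nat 6 rfl]
  · intro i s' hi hf hx hs'
    have h6 := hf.cell rfl 6 rfl
    simp only [Memory.real_setReal_apply, eval] at h6
    refine Run.setReal ?_
    simp [hs', h6, add_mul]
  intro s₁ hf₁ h₁
  have e3 : s₁.real 0 3 = s.real 0 3 := by simpa using hf₁.cell rfl 3 rfl
  have e7 : s₁.nat 7 = s.nat 7 := by simpa using hf₁.nat 7 rfl
  -- Cell `2` holds the next multiple to be tested. Either all tests so far succeeded and the count
  -- equals `i`, or that multiple already exceeds `Q * x` and the count stays fixed.
  refine Run.setReal_seq (Run.setNat_seq ((Run.forRange (fun i s' => s'.nat 26 0 ≤ i ∧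
    s'.real 0 2 = (s'.nat 26 0 + 1) * s.real 0 3 ∧
    s'.nat 26 0 * s.real 0 3 ≤ s.nat 6 0 * s.real 0 6 ∧
    (s'.nat 26 0 = i ∨ s.nat 6 0 * s.real 0 6 < (s'.nat 26 0 + 1) * s.real 0 3))
    (s.nat 7 0) hK rfl ?_ ?_ ?_).imp ?_))
  · intro s' hf
    simp [hf.nat 7 rfl, e7]
  · simp [e3]; positivity
  · rintro i s' hi hf hx ⟨h2, h3, h4, h5⟩
    have e1 : s'.real 0 1 = s.nat 6 0 * s.real 0 6 := by
      have := hf.cell rfl 1 rfl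
      simpa [h₁] using this
    have e3' : s'.real 0 3 = s.real 0 3 := by
      have := hf.cell rfl 3 rfl
      simpa [e3] using this
    refine Run.ite (fun hb => Run.setNat_seq (Run.setReal ?_)) fun hb => Run.skip ?_
    · simp only [Test.Holds, RealExpr.eval, eval, e1, h3] at hb
      have : s'.nat 26 0 = i := h5.resolve_right (not_lt.2 hb)
      rw [this] at hb h3
      simp [this, h3, e3']
      exact ⟨by ring, hb⟩
    · simp only [Test.Holds, RealExpr.eval, eval, e1, h3, not_le] at hb
      simp only [Memory.nat_setNat_apply, Memory.real_setNat]
      simp [h3, h4, hb]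
      omega
  · rintro s' - ⟨h2, h3, h4, h5⟩
    exact ⟨h2, h4, h5⟩

/-- The weight of an item that is put into the `k`-th bundle. -/
def weight (n ℓ b : ℕ) (c r : ℕ → ℕ) (g k : ℕ) : ℕ :=
  (b ^ ℓ * r g + b ^ c g) * (b ^ (ℓ + 1)) ^ k + (b ^ (ℓ + 1)) ^ n

/-- Fill the array `12` with the weights of the items, with the item in the variable `19` as unit
of the values, which are given by the array `U`. -/
def weightProg (n ℓ U : ℕ) : Program :=
  absProg 3 (.read U (.var 19)) ⨟
  .forRange 23 (.var 0) (absProg 6 (.read U (.var 23)) ⨟ roundProg ⨟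
    mulProg (.read 9 (.const ℓ)) (.var 26) ⨟
    .setNat 28 (.const 0) (.add (.var 20) (.read 9 (.read 1 (.var 23)))) ⨟
    .forRange 24 (.const n) (mulProg (.var 28) (.read 10 (.var 24)) ⨟
      .setNat 12 (.add (.smul n (.var 23)) (.var 24)) (.add (.var 20) (.read 10 (.const n)))))

theorem run_weightProg {n ℓ U k N : ℕ} {s : Memory} (hn : 0 < n) (hs : Params n ℓ k s)
    (hN : tableSize n ℓ (s.nat 0 0) k + k + n + ℓ + 1 ≤ N) (hc : ∀ g < s.nat 0 0, s.nat 1 g < ℓ) :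
    Run N (weightProg n ℓ (U + 1)) s fun s' => ∃ r : ℕ → ℕ,
      (∀ g < s.nat 0 0, IsRound (s.nat 0 0 * k) (s.nat 0 0 * (s.nat 0 0 * k))
        |s.real (U + 1) (s.nat 19 0)| |s.real (U + 1) g| (r g)) ∧
      ∀ g < s.nat 0 0, ∀ i < n, s'.nat 12 (n * g + i) =
        weight n ℓ (digitBase (s.nat 0 0) k) (s.nat 1) r g i := by
  obtain ⟨hQ, hK, h9, h10, -⟩ := hs
  have hm := lt_tableSize n ℓ (s.nat 0 0) k
  have hcap := cap_le_digitBase (s.nat 0 0) k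
  have hbase := digitBase_le_tableSize (ℓ := ℓ) (m := s.nat 0 0) (k := k) hn
  set m := s.nat 0 0 with hm'
  set b := digitBase m k with hb
  have hmb : m * k ≤ m * (m * k) := by
    rcases Nat.eq_zero_or_pos m with h | h
    · simp [h]
    · exact Nat.le_mul_of_pos_left _ h
  refine Run.seq (run_absProg _ _) ?_
  rintro s₁ hf₁ ⟨h₁, e₁⟩
  have er₁ := hf₁.real rfl U
  simp only [RealExpr.eval, eval] at h₁
  refine (Run.forRange (fun i s' => ∀ g < i, ∃ r : ℕ, IsRound (m * k) (m * (m * k))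
      |s.real (U + 1) (s.nat 19 0)| |s.real (U + 1) g| r ∧
      ∀ j < n, s'.nat 12 (n * g + j) =
        (b ^ ℓ * r + b ^ s.nat 1 g) * (b ^ (ℓ + 1)) ^ j + (b ^ (ℓ + 1)) ^ n)
    m (by omega) rfl ?_ (by simp) ?_).imp ?_
  · intro s' hf
    simp [hf.nat 0 rfl, e₁, hm']
  · intro i s' hi hf hx hs'
    have f (a : ℕ) (ha : writesNat a (forRange 23 (var 0) (absProg 6 (.read (U + 1) (.var 23)) ⨟
        roundProg ⨟ mulProg (.read 9 (.const ℓ)) (.var 26) ⨟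
        .setNat 28 (.const 0) (.add (.var 20) (.read 9 (.read 1 (.var 23)))) ⨟
        .forRange 24 (.const n) (mulProg (.var 28) (.read 10 (.var 24)) ⨟
          .setNat 12 (.add (.smul n (.var 23)) (.var 24)) (.add (.var 20) (.read 10 (.const n))))))
        = false) : s'.nat a = s.nat a := by rw [hf.nat a ha, e₁]
    have f3 : s'.real 0 3 = |s.real (U + 1) (s.nat 19 0)| := by rw [hf.cell rfl 3 rfl, h₁]
    have fU : s'.real (U + 1) = s.real (U + 1) := by rw [hf.real rfl, er₁]
    refine Run.seq (run_absProg _ _) ?_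
    rintro s₂ hf₂ ⟨h₂, e₂⟩
    simp only [RealExpr.eval, eval, fU, hx] at h₂
    refine Run.seq (run_roundProg (by rw [e₂, f 6 rfl]; omega) (by rw [e₂, f 7 rfl]; omega)
      (by rw [h₂]; positivity)) fun s₃ hf₃ h₃ => ?_
    rw [e₂, f 6 rfl, f 7 rfl, hQ, hK, h₂, hf₂.cell rfl 3 rfl, f3] at h₃
    set r := s₃.nat 26 0 with hr
    have hr' := h₃.le_cap
    refine Run.seq (run_mulProg (a := b ^ ℓ) (b := r) _ _ (by omega)
      (fun s'' hs'' => by simp [hs''.nat 9 rfl, hf₃.nat 9 rfl, e₂, f 9 rfl, h9])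
      fun s'' hs'' => by simp [hs''.nat 26 rfl, hr]) fun s₄ hf₄ h₄ => Run.setNat_seq ?_
    set s₅ := s₄.setNat 28 _ _ with hs₅
    have h₅ (a : ℕ) (ha : a ≠ 28) (h1 : writesNat a roundProg = false)
        (h2 : writesNat a (mulProg (.read 9 (.const ℓ)) (.var 26)) = false) :
        s₅.nat a = s'.nat a := by
      rw [hs₅, Memory.nat_setNat_of_ne _ _ _ _ _ ha, hf₄.nat a h2, hf₃.nat a h1, e₂]
    have h₅' : s₅.nat 28 0 = b ^ ℓ * r + b ^ s.nat 1 i := by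
      simp [hs₅, h₄, hf₄.nat 9 rfl, hf₃.nat 9 rfl, e₂, f 9 rfl, hf₄.nat 1 rfl, hf₃.nat 1 rfl,
        f 1 rfl, hf₄.nat 23 rfl, hf₃.nat 23 rfl, hx]
      rw [h9 _ (by have := hc i hi; omega)]
    clear_value s₅
    -- Array `12` is an `n`-column matrix stored row by row. The second clause keeps the rows of the
    -- earlier items.
    refine (Run.forRange (fun j s'' => (∀ j' < j, s''.nat 12 (n * i + j') =
      (b ^ ℓ * r + b ^ s.nat 1 i) * (b ^ (ℓ + 1)) ^ j' + (b ^ (ℓ + 1)) ^ n) ∧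
      ∀ y < n * i, s''.nat 12 y = s'.nat 12 y) n (by omega) rfl (fun _ _ => rfl) ?_ ?_).imp ?_
    · simp [h₅ 12 (by decide) rfl rfl]
    · rintro j s'' hj hf' hx' ⟨h1, h2⟩
      have hp : (b ^ (ℓ + 1)) ^ j ≤ tableSize n ℓ m k := pow_le_tableSize hj.le
      have f10 : s''.nat 10 = s.nat 10 := by
        rw [hf'.nat 10 rfl, h₅ 10 (by decide) rfl rfl, f 10 rfl]
      have f23 : s''.nat 23 0 = i := by
        rw [hf'.nat 23 rfl, h₅ 23 (by decide) rfl rfl, hx]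
      refine Run.seq (run_mulProg (a := b ^ ℓ * r + b ^ s.nat 1 i) (b := (b ^ (ℓ + 1)) ^ j) _ _
        (by omega) (fun s hs => by simp [hs.nat 28 rfl, hf'.nat 28 rfl, h₅'])
        fun s hs => by simp [hs.nat 10 rfl, hs.nat 24 rfl, hx', f10, h10 j hj.le])
        fun s₆ hf₆ h₆ => Run.setNat ?_
      simp only [eval, eval_smul, hf₆.nat 23 rfl, f23, hf₆.nat 24 rfl, hx', h₆, hf₆.nat 10 rfl,
        f10, h10 n le_rfl, Memory.nat_setNat_apply]
      refine ⟨fun j' hj' => ?_, fun y hy => ?_⟩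
      · rcases Nat.lt_or_ge j' j with h | h
        · simp [h.ne, hf₆.nat 12 rfl, h1 j' h]
        · obtain rfl : j' = j := by omega
          simp
      · have : y ≠ n * i + j := by omega
        simp [this, hf₆.nat 12 rfl, h2 y hy]
    · rintro s'' - ⟨h1, h2⟩ g hg
      rcases Nat.lt_or_ge g i with h | h
      · obtain ⟨r', hr', h'⟩ := hs' g h
        refine ⟨r', hr', fun j hj => ?_⟩
        have : n * g + j < n * i := by
          calc n * g + j < n * (g + 1) := by rw [mul_add]; omega
            _ ≤ n * i := by gcongr; omega
        simpa [h2 _ this] using h' j hj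
      · obtain rfl : g = i := by omega
        exact ⟨r, h₃, by simpa using h1⟩
  · intro s' hf hs'
    choose! r hr using hs'
    exact ⟨r, fun g hg => (hr g hg).1, fun g hg => (hr g hg).2⟩

end RAM

/-! ### Positional encoding of partial allocations and its table -/

namespace RAM

/-! ### Keys of partial allocations -/

theorem sum_mul_pow_lt {b d : ℕ} {f : ℕ → ℕ} (hf : ∀ i < d, f i < b) :
    ∑ i ∈ range d, f i * b ^ i < b ^ d := by
  induction d with
  | zero => simp
  | succ d ih =>
    have h1 := ih fun i hi => hf i (by omega)
    have h2 : (f d + 1) * b ^ d ≤ b * b ^ d := Nat.mul_le_mul_right _ (hf d (by omega))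
    rw [sum_range_succ, pow_succ']
    linarith [add_mul (f d) 1 (b ^ d)]

theorem eq_of_sum_mul_pow_eq {b d : ℕ} {f f' : ℕ → ℕ} (hf : ∀ i < d, f i < b)
    (hf' : ∀ i < d, f' i < b)
    (h : ∑ i ∈ range d, f i * b ^ i = ∑ i ∈ range d, f' i * b ^ i) : ∀ i < d, f i = f' i := by
  induction d with
  | zero => simp
  | succ d ih =>
    have h1 := sum_mul_pow_lt (f := f) (d := d) fun i hi => hf i (by omega)
    have h2 := sum_mul_pow_lt (f := f') (d := d) fun i hi => hf' i (by omega)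
    rw [sum_range_succ, sum_range_succ] at h
    have h3 : f d = f' d := by
      -- Division by `b ^ d` isolates the leading digit, since the lower digits sum to less than `b
      -- ^ d`.
      have := congrArg (· / b ^ d) h
      simpa [Nat.add_mul_div_right _ _ (Nat.zero_lt_of_lt h1), Nat.div_eq_of_lt h1,
        Nat.div_eq_of_lt h2] using this
    intro i hi
    rcases Nat.lt_or_ge i d with hi' | hi'
    · exact ih (fun i hi => hf i (by omega)) (fun i hi => hf' i (by omega))
        (by rw [h3] at h; omega) i hi'
    · obtain rfl : i = d := by omega
      exact h3

/-- The key of the allocation `A` of the first `t` items. -/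
def key (D : ℕ → ℕ → ℕ) (A : ℕ → ℕ) (t : ℕ) : ℕ := ∑ g ∈ range t, D g (A g)

theorem key_succ (D : ℕ → ℕ → ℕ) (A : ℕ → ℕ) (t : ℕ) : key D A (t + 1) = key D A t + D t (A t) :=
  sum_range_succ _ _

theorem key_congr {D : ℕ → ℕ → ℕ} {A A' : ℕ → ℕ} {t : ℕ} (h : ∀ g < t, A g = A' g) :
    key D A t = key D A' t := sum_congr rfl fun g hg => by rw [h g (mem_range.1 hg)]

/-- The sum of the rounded values in the bundle of the items with label `k`. -/
def bundleRound (m : ℕ) (A r : ℕ → ℕ) (k : ℕ) : ℕ := ∑ g ∈ range m with A g = k, r g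

/-- The digits of the bundle with label `k`. -/
def bundleDigit (ℓ t : ℕ) (A c r : ℕ → ℕ) (k j : ℕ) : ℕ :=
  if j = ℓ then bundleRound t A r k else bundleCount t A c k j

theorem sum_bundleDigit {ℓ t b : ℕ} {A c r : ℕ → ℕ} (hc : ∀ g < t, c g < ℓ) (k : ℕ) :
    ∑ j ∈ range (ℓ + 1), bundleDigit ℓ t A c r k j * b ^ j =
      ∑ g ∈ range t with A g = k, (b ^ ℓ * r g + b ^ c g) := by
  rw [sum_range_succ, sum_add_distrib, add_comm]
  congr 1
  · simp [bundleDigit, bundleRound, mul_comm, mul_sum]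
  · have h1 : ∀ j ∈ range ℓ, bundleDigit ℓ t A c r k j * b ^ j =
        ∑ g ∈ range t with A g = k, if c g = j then b ^ j else 0 := fun j hj => by
      rw [bundleDigit, if_neg (mem_range.1 hj).ne, bundleCount, ← filter_filter, ← sum_filter,
        sum_const, smul_eq_mul]
    rw [sum_congr rfl h1, sum_comm]
    refine sum_congr rfl fun g hg => ?_
    rw [mem_filter, mem_range] at hg
    rw [sum_ite_eq, if_pos (mem_range.2 (hc g hg.1))]

/-- The key in base `b ^ (ℓ + 1)`: place `k` describes bundle `k`, and everything from place `n`
upwards is the number `t` of items. Within place `k`, the base-`b` digits below `ℓ` are the category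
counts and digit `ℓ` is the rounded value. -/
theorem key_weight {n ℓ t b : ℕ} {A c r : ℕ → ℕ} (hc : ∀ g < t, c g < ℓ) (hA : ∀ g < t, A g < n) :
    key (weight n ℓ b c r) A t = t * (b ^ (ℓ + 1)) ^ n + ∑ k ∈ range n,
      (∑ j ∈ range (ℓ + 1), bundleDigit ℓ t A c r k j * b ^ j) * (b ^ (ℓ + 1)) ^ k := by
  unfold key weight
  rw [sum_add_distrib, add_comm]
  congr 1
  · simp
  · simp only [sum_bundleDigit hc, sum_mul]
    simp only [sum_filter]
    rw [sum_comm]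
    refine sum_congr rfl fun g hg => ?_
    rw [sum_ite_eq, if_pos (mem_range.2 (hA g (mem_range.1 hg)))]

/-- This explains `digitBase`: at most `m` items each add `1` to a count or at most the cap `m * (m
* k')` to a rounded value, so no digit overflows. -/
theorem bundleDigit_lt {ℓ m t k' : ℕ} {A c r : ℕ → ℕ} (ht : t ≤ m)
    (hr : ∀ g < m, r g ≤ m * (m * k')) (k j : ℕ) :
    bundleDigit ℓ t A c r k j < digitBase m k' := by
  have hcard : ∀ (p : ℕ → Prop) [DecidablePred p], #{g ∈ range t | p g} ≤ m := fun p _ =>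
    (card_filter_le _ _).trans (by simpa using ht)
  unfold bundleDigit digitBase
  split_ifs
  · have : bundleRound t A r k ≤ m * (m * (m * k')) := by
      calc bundleRound t A r k ≤ #{g ∈ range t | A g = k} • (m * (m * k')) :=
            sum_le_card_nsmul _ _ _ fun g hg => hr g (by
              rw [mem_filter, mem_range] at hg; omega)
        _ ≤ _ := by rw [smul_eq_mul]; gcongr; exact hcard _
    rw [mul_add]; omega
  · have : bundleCount t A c k j ≤ m := hcard _
    have : m * 1 ≤ m * (m * (m * k') + 1) := by gcongr; omega
    omega

/-- The properties of the weights that the dynamic program relies on. -/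
structure GoodWeights (n m M : ℕ) (D : ℕ → ℕ → ℕ) : Prop where
  pos : ∀ g k, 0 < D g k
  layer : ∀ A A' t t', t ≤ m → t' ≤ m → (∀ g < t, A g < n) → (∀ g < t', A' g < n) →
    key D A t = key D A' t' → t = t'
  lt : ∀ A t, t ≤ m → (∀ g < t, A g < n) → key D A t < M

section

variable {n ℓ m k' : ℕ} {c r : ℕ → ℕ}

theorem sum_sum_bundleDigit_lt (hr : ∀ g < m, r g ≤ m * (m * k')) {A : ℕ → ℕ} {t : ℕ}
    (ht : t ≤ m) :
    ∑ k ∈ range n, (∑ j ∈ range (ℓ + 1), bundleDigit ℓ t A c r k j * digitBase m k' ^ j) *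
      (digitBase m k' ^ (ℓ + 1)) ^ k < (digitBase m k' ^ (ℓ + 1)) ^ n :=
  sum_mul_pow_lt fun _ _ => sum_mul_pow_lt fun _ _ => bundleDigit_lt ht hr _ _

/-- The summand `(b ^ (ℓ + 1)) ^ n` of every weight makes weights positive and counts items: since
the part describing the bundles is smaller than this power, dividing the key by it returns `t`. It
also places keys below `m + 1` times the power, which is the table size. -/
theorem goodWeights_weight (hc : ∀ g < m, c g < ℓ) (hr : ∀ g < m, r g ≤ m * (m * k')) :
    GoodWeights n m (tableSize n ℓ m k') (weight n ℓ (digitBase m k') c r) where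
  pos g k := by
    have : 0 < (digitBase m k' ^ (ℓ + 1)) ^ n := pow_pos (pow_pos (digitBase_pos _ _) _) _
    unfold weight; omega
  layer A A' t t' ht ht' hA hA' h := by
    rw [key_weight (fun g hg => hc g (by omega)) hA,
      key_weight (fun g hg => hc g (by omega)) hA'] at h
    have h1 := sum_sum_bundleDigit_lt (n := n) (ℓ := ℓ) (c := c) hr (A := A) ht
    have h2 := sum_sum_bundleDigit_lt (n := n) (ℓ := ℓ) (c := c) hr (A := A') ht'
    have := congrArg (· / (digitBase m k' ^ (ℓ + 1)) ^ n) h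
    have hp := Nat.zero_lt_of_lt h1
    simpa only [add_comm (_ * (digitBase m k' ^ (ℓ + 1)) ^ n), Nat.add_mul_div_right _ _ hp,
      Nat.div_eq_of_lt h1, Nat.div_eq_of_lt h2, zero_add] using this
  lt A t ht hA := by
    rw [key_weight (fun g hg => hc g (by omega)) hA]
    have h1 := sum_sum_bundleDigit_lt (n := n) (ℓ := ℓ) (c := c) hr (A := A) ht
    calc _ < t * (digitBase m k' ^ (ℓ + 1)) ^ n + (digitBase m k' ^ (ℓ + 1)) ^ n := by gcongr
      _ = (t + 1) * (digitBase m k' ^ (ℓ + 1)) ^ n := by ring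
      _ ≤ _ := by unfold tableSize; gcongr

/-- Allocations with the same key have the same counts and the same rounded values. -/
theorem eq_of_key_eq (hc : ∀ g < m, c g < ℓ) (hr : ∀ g < m, r g ≤ m * (m * k')) {A A' : ℕ → ℕ}
    (hA : ∀ g < m, A g < n) (hA' : ∀ g < m, A' g < n)
    (h : key (weight n ℓ (digitBase m k') c r) A m =
      key (weight n ℓ (digitBase m k') c r) A' m) {k : ℕ} (hk : k < n) :
    bundleRound m A r k = bundleRound m A' r k ∧
      ∀ j < ℓ, bundleCount m A c k j = bundleCount m A' c k j := by
  rw [key_weight hc hA, key_weight hc hA', add_right_inj] at h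
  -- Digits are compared on two levels: first the places of the bundles, then the digits inside one
  -- place.
  have h1 := eq_of_sum_mul_pow_eq (fun _ _ => sum_mul_pow_lt fun _ _ => bundleDigit_lt le_rfl hr _ _)
    (fun _ _ => sum_mul_pow_lt fun _ _ => bundleDigit_lt le_rfl hr _ _) h k hk
  have h2 := eq_of_sum_mul_pow_eq (fun _ _ => bundleDigit_lt le_rfl hr _ _)
    (fun _ _ => bundleDigit_lt le_rfl hr _ _) h1
  refine ⟨by simpa [bundleDigit] using h2 ℓ (by omega), fun j hj => ?_⟩
  simpa [bundleDigit, hj.ne] using h2 j (by omega)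

end

/-! ### The table of the dynamic program -/

/-- The entries of a table below `M` that are not zero describe partial allocations: if
`L y = t + 1`, then `y` is the key of an allocation of the first `t` items, and `B y` is the label
of the last one of these items in such an allocation. -/
structure IsTable (n m M : ℕ) (D : ℕ → ℕ → ℕ) (L B : ℕ → ℕ) : Prop where
  first : ∀ y < M, L y = 1 → y = 0
  prev : ∀ y < M, ∀ t, L y = t + 2 → B y < n ∧ D t (B y) ≤ y ∧ L (y - D t (B y)) = t + 1
  key : ∀ y < M, ∀ t, L y = t + 1 → t ≤ m ∧ ∃ A : ℕ → ℕ, (∀ g < t, A g < n) ∧ key D A t = y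

section

variable {n m M x t k : ℕ} {D : ℕ → ℕ → ℕ} {L B : ℕ → ℕ}

theorem IsTable.extend (hT : IsTable n m M D L B) (hx : x < M) (hL : L x = t + 1)
    (ht : t < m) (hk : k < n) :
    ∃ A : ℕ → ℕ, (∀ g < t + 1, A g < n) ∧ RAM.key D A (t + 1) = x + D t k := by
  obtain ⟨-, A, hA, hAx⟩ := hT.key x hx t hL
  refine ⟨Function.update A t k, fun g hg => ?_, ?_⟩
  · rcases Nat.lt_or_ge g t with h | h
    · rw [Function.update_of_ne h.ne]; exact hA g h
    · obtain rfl : g = t := by omega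
      simpa using hk
  · rw [key_succ, key_congr (A' := A), hAx, Function.update_self]
    intro g hg
    rw [Function.update_of_ne hg.ne]

/-- A key determines the number of items it describes (`layer`), so different partial allocations
reaching the same entry agree on its level. -/
theorem IsTable.eq_of_ne_zero (hD : GoodWeights n m M D) (hT : IsTable n m M D L B) (hx : x < M)
    (hL : L x = t + 1) (ht : t < m) (hk : k < n) (h0 : L (x + D t k) ≠ 0) :
    L (x + D t k) = t + 2 := by
  obtain ⟨A, hA, hAx⟩ := hT.extend hx hL ht hk
  have hM : x + D t k < M := hAx ▸ hD.lt A (t + 1) ht hA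
  obtain ⟨t', ht'⟩ := Nat.exists_eq_succ_of_ne_zero h0
  obtain ⟨h1, A', hA', hAx'⟩ := hT.key _ hM t' ht'
  have := hD.layer A A' (t + 1) t' ht h1 hA hA' (hAx.trans hAx'.symm)
  omega

/-- Overwriting an entry is harmless: its level does not change, and back pointers of other entries
depend only on the level of their predecessor. -/
theorem IsTable.update (hD : GoodWeights n m M D) (hT : IsTable n m M D L B) (hx : x < M)
    (hL : L x = t + 1) (ht : t < m) (hk : k < n) :
    IsTable n m M D (Function.update L (x + D t k) (t + 2)) (Function.update B (x + D t k) k) := by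
  have h0 := hT.eq_of_ne_zero hD hx hL ht hk
  obtain ⟨A, hA, hAx⟩ := hT.extend hx hL ht hk
  have hM : x + D t k < M := hAx ▸ hD.lt A (t + 1) ht hA
  have hpos := hD.pos t k
  have hL' : ∀ z v, L z = v + 1 → Function.update L (x + D t k) (t + 2) z = v + 1 := by
    intro z v hz
    rw [Function.update_apply]
    split_ifs with h
    · rw [← hz, h, h0]; rw [← h]; omega
    · exact hz
  constructor
  · intro y hy h
    rw [Function.update_apply] at h
    split_ifs at h with h'
    · omega
    · exact hT.first y hy h
  · intro y hy v h
    by_cases h' : y = x + D t k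
    · subst h'
      rw [Function.update_self] at h
      obtain rfl : t = v := by omega
      simpa [hk] using hL' x t hL
    · rw [Function.update_of_ne h'] at h
      rw [Function.update_of_ne h']
      obtain ⟨h1, h2, h3⟩ := hT.prev y hy v h
      exact ⟨h1, h2, hL' _ _ h3⟩
  · intro y hy v h
    by_cases h' : y = x + D t k
    · rw [h', Function.update_self] at h
      obtain rfl : v = t + 1 := by omega
      exact ⟨ht, A, hA, h' ▸ hAx⟩
    · rw [Function.update_of_ne h'] at h
      exact hT.key y hy v h

end

end RAM

/-! ### Filling the table and tracing back -/

namespace RAM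

open NatExpr Program

/-! ### The dynamic program -/

/-- Fill the arrays `13` and `14` with the table of all partial allocations. -/
def tableProg (n : ℕ) : Program :=
  .forRange 29 (.var 11) (.setNat 13 (.var 29) (.const 0)) ⨟
  .setNat 13 (.const 0) (.const 1) ⨟
  .forRange 29 (.var 11) (.ite
    (.and (.natLe (.const 1) (.read 13 (.var 29))) (.natLe (.read 13 (.var 29)) (.var 0)))
    (.setNat 23 (.const 0) (.sub (.read 13 (.var 29)) (.const 1)) ⨟
      .forRange 24 (.const n)
        (.setNat 28 (.const 0) (.add (.var 29) (.read 12 (.add (.smul n (.var 23)) (.var 24)))) ⨟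
        .setNat 13 (.var 28) (.add (.var 23) (.const 2)) ⨟
        .setNat 14 (.var 28) (.var 24)))
    .skip)

/-- One pass through the keys in increasing order is enough: weights are positive, so an extension
always has a larger key than the allocation it extends. The start is the empty allocation, with key
`0` and level `1`; level `0` marks unused entries. -/
theorem run_tableProg {n M N : ℕ} {s : Memory} {D : ℕ → ℕ → ℕ} (hD : GoodWeights n (s.nat 0 0) M D)
    (hM : s.nat 11 0 = M) (hMN : M ≤ N) (hnN : n ≤ N) (hM0 : 0 < M)
    (hw : ∀ g < s.nat 0 0, ∀ k < n, s.nat 12 (n * g + k) = D g k) :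
    Run N (tableProg n) s fun s' => IsTable n (s.nat 0 0) M D (s'.nat 13) (s'.nat 14) ∧
      ∀ A : ℕ → ℕ, (∀ g < s.nat 0 0, A g < n) →
        s'.nat 13 (key D A (s.nat 0 0)) = s.nat 0 0 + 1 := by
  refine Run.seq (Run.forRange (fun i s' => ∀ y < i, s'.nat 13 y = 0) M hMN rfl
    (fun s' hf => by simp [hf.nat 11 rfl, hM]) (by simp) ?_) ?_
  · intro i s' hi hf hx hs'
    refine Run.setNat fun y hy => ?_
    simp only [eval, hx, Memory.nat_setNat_apply]
    simp only [(by decide : ¬ 13 = 29), false_and, if_false, true_and]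
    split_ifs with h
    · rfl
    · exact hs' y (by omega)
  intro s₁ hf₁ h₁
  refine Run.setNat_seq ?_
  set s₂ := s₁.setNat 13 _ _ with hs₂
  have f₂ (a : ℕ) (ha : a ≠ 13) (ha' : writesNat a
      (.forRange 29 (.var 11) (.setNat 13 (.var 29) (.const 0))) = false) :
      s₂.nat a = s.nat a := by
    rw [hs₂, Memory.nat_setNat_of_ne _ _ _ _ _ ha, hf₁.nat a ha']
  have h₂ : ∀ y < M, s₂.nat 13 y = if y = 0 then 1 else 0 := by
    intro y hy
    simp [hs₂, h₁ y hy]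
  clear_value s₂
  set m := s.nat 0 0 with hm
  refine (Run.forRange (fun x s' => IsTable n m M D (s'.nat 13) (s'.nat 14) ∧ s'.nat 13 0 = 1 ∧
    ∀ A : ℕ → ℕ, (∀ g < m, A g < n) → ∀ t < m, key D A t < x →
      s'.nat 13 (key D A (t + 1)) = t + 2) M hMN rfl
    (fun s' hf => by simp [hf.nat 11 rfl, f₂ 11 (by decide) rfl, hM]) ?_ ?_).imp ?_
  · refine ⟨⟨fun y hy h => ?_, fun y hy t h => ?_, fun y hy t h => ?_⟩, ?_, by simp⟩
    all_goals simp only [Memory.nat_setNat_of_ne _ _ _ _ _ (by decide : 13 ≠ 29)] at *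
    · rw [h₂ y hy] at h; split_ifs at h with h'; exact h'
    · rw [h₂ y hy] at h; split_ifs at h; omega
    · rw [h₂ y hy] at h
      split_ifs at h with h'
      obtain rfl : t = 0 := by omega
      exact ⟨Nat.zero_le _, 0, by simp, by simp [key, h']⟩
    · simp [h₂ 0 hM0]
  · rintro x s' hx hf hx' ⟨hT, h0, hC⟩
    have f0 : s'.nat 0 = s.nat 0 := by rw [hf.nat 0 rfl, f₂ 0 (by decide) rfl]
    have f12 : s'.nat 12 = s.nat 12 := by rw [hf.nat 12 rfl, f₂ 12 (by decide) rfl]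
    -- When the scan arrives at `x`, this entry is already set, because the allocation without its
    -- last item has a smaller key.
    have hx0 : ∀ A : ℕ → ℕ, (∀ g < m, A g < n) → ∀ t < m, key D A t = x → s'.nat 13 x = t + 1 := by
      intro A hA t ht hxt
      cases t with
      | zero => simpa [← hxt, key] using h0
      | succ t =>
        rw [← hxt]
        refine hC A hA t (by omega) ?_
        rw [← hxt, key_succ]
        exact Nat.lt_add_of_pos_right (hD.pos _ _)
    refine Run.ite (fun hb => Run.setNat_seq ?_) fun hb => Run.skip ?_
    · simp only [Test.Holds, eval, hx', f0] at hb
      obtain ⟨t, ht⟩ : ∃ t, s'.nat 13 x = t + 1 := ⟨s'.nat 13 x - 1, by omega⟩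
      have htm : t < m := by omega
      refine (Run.forRange (fun j s'' => IsTable n m M D (s''.nat 13) (s''.nat 14) ∧
        (∀ z v, s'.nat 13 z = v + 1 → s''.nat 13 z = v + 1) ∧
        ∀ k < j, s''.nat 13 (x + D t k) = t + 2) n hnN rfl (fun _ _ => rfl) ?_ ?_).imp ?_
      · simp [hT]
      · rintro k s'' hk hf'' hk' ⟨hT'', hz, hkk⟩
        have f29 : s''.nat 29 0 = x := by rw [hf''.nat 29 rfl]; simpa using hx'
        have f23 : s''.nat 23 0 = t := by rw [hf''.nat 23 rfl]; simp [hx', ht]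
        have f12' : s''.nat 12 = s.nat 12 := by rw [hf''.nat 12 rfl]; simpa using f12
        refine Run.setNat_seq (Run.setNat_seq (Run.setNat ?_))
        simp only [eval, eval_smul, f29, f23, hk', f12', hw t htm k hk]
        have hL := hz x t ht
        have key1 := hT''.update hD hx hL htm hk
        have key2 := hT''.eq_of_ne_zero hD hx hL htm hk
        set s₃ := (((s''.setNat 28 0 (x + D t k)).setNat 13 _ _).setNat 14 _ _).setNat 24 0 (k + 1)
          with hs₃
        have e13 : s₃.nat 13 = Function.update (s''.nat 13) (x + D t k) (t + 2) := by
          funext z; simp [hs₃, Function.update_apply, f23]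
        have e14 : s₃.nat 14 = Function.update (s''.nat 14) (x + D t k) k := by
          funext z; simp [hs₃, Function.update_apply, hk']
        clear_value s₃
        rw [e13, e14]
        refine ⟨key1, fun z v h => ?_, fun k' hk'' => ?_⟩
        · rw [Function.update_apply]
          split_ifs with h'
          · rw [← hz z v h, h', key2 (by rw [← h', hz z v h]; omega)]
          · exact hz z v h
        · rw [Function.update_apply]
          split_ifs with h'
          · rfl
          · exact hkk k' (by
              rcases Nat.lt_or_ge k' k with h | h
              · exact h
              · exact absurd (by rw [(by omega : k' = k)]) h')
      · rintro s'' - ⟨hT'', hz, hkk⟩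
        simp only [Memory.nat_setNat_of_ne _ _ _ _ _ (by decide : 13 ≠ 29),
          Memory.nat_setNat_of_ne _ _ _ _ _ (by decide : 14 ≠ 29)]
        refine ⟨hT'', hz 0 0 h0, fun A hA t' ht' hlt => ?_⟩
        rcases Nat.lt_or_ge (key D A t') x with h | h
        · exact hz _ _ (hC A hA t' ht' h)
        · have hxt : key D A t' = x := by omega
          have := hx0 A hA t' ht' hxt
          obtain rfl : t = t' := by omega
          rw [key_succ, hxt]
          exact hkk _ (hA t htm)
    · simp only [Test.Holds, eval, hx', f0] at hb
      simp only [Memory.nat_setNat_of_ne _ _ _ _ _ (by decide : 13 ≠ 29),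
        Memory.nat_setNat_of_ne _ _ _ _ _ (by decide : 14 ≠ 29)]
      refine ⟨hT, h0, fun A hA t' ht' hlt => ?_⟩
      rcases Nat.lt_or_ge (key D A t') x with h | h
      · exact hC A hA t' ht' h
      · have := hx0 A hA t' ht' (by omega)
        omega
  · rintro s' - ⟨hT, h0, hC⟩
    refine ⟨hT, fun A hA => ?_⟩
    rcases Nat.eq_zero_or_pos m with h | h
    · rw [h]; exact h0
    · obtain ⟨t, ht⟩ := Nat.exists_eq_succ_of_ne_zero h.ne'
      rw [ht]
      exact hC A hA t (by omega) (hD.lt A t (by omega) fun g hg => hA g (by omega))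

/-- Fill the array `15` with the labels of an allocation whose key is in the variable `29`. -/
def traceProg (n : ℕ) : Program :=
  .setNat 30 (.const 0) (.var 29) ⨟
  .forRange 31 (.var 0)
    (.setNat 28 (.const 0) (.sub (.sub (.var 0) (.const 1)) (.var 31)) ⨟
    .setNat 15 (.var 28) (.read 14 (.var 30)) ⨟
    .setNat 30 (.const 0) (.sub (.var 30)
      (.read 12 (.add (.smul n (.var 28)) (.read 15 (.var 28))))))

/-- Back pointers are followed from the last item down. After `i` rounds the last `i` labels are
known, and variable `30` holds `x` minus their weights, an entry of level `m - i + 1`. -/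
theorem run_traceProg {n M N x : ℕ} {s : Memory} {D : ℕ → ℕ → ℕ}
    (hT : IsTable n (s.nat 0 0) M D (s.nat 13) (s.nat 14)) (hmN : s.nat 0 0 ≤ N) (hxM : x < M)
    (hw : ∀ g < s.nat 0 0, ∀ k < n, s.nat 12 (n * g + k) = D g k) (hx : s.nat 29 0 = x)
    (hL : s.nat 13 x = s.nat 0 0 + 1) :
    Run N (traceProg n) s fun s' => (∀ g < s.nat 0 0, s'.nat 15 g < n) ∧
      key D (s'.nat 15) (s.nat 0 0) = x := by
  set m := s.nat 0 0 with hm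
  refine Run.setNat_seq ((Run.forRange (fun i s' => s'.nat 30 0 < M ∧
    s.nat 13 (s'.nat 30 0) = m - i + 1 ∧ (∀ g < m, m - i ≤ g → s'.nat 15 g < n) ∧
    s'.nat 30 0 + ∑ g ∈ Ico (m - i) m, D g (s'.nat 15 g) = x) m hmN rfl
    (fun s' hf => by simp [hf.nat 0 rfl, hm]) ?_ ?_).imp ?_)
  · refine ⟨by simpa [hx] using hxM, by simp [hx, hL], fun g hg hg' => by omega, by simp [hx]⟩
  · rintro i s' hi hf hi' ⟨h1, h2, h3, h4⟩
    have f14 : s'.nat 14 = s.nat 14 := by rw [hf.nat 14 rfl]; rfl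
    have f12 : s'.nat 12 = s.nat 12 := by rw [hf.nat 12 rfl]; rfl
    have f0 : s'.nat 0 = s.nat 0 := by rw [hf.nat 0 rfl]; rfl
    obtain ⟨t, ht⟩ : ∃ t, m - i = t + 1 := ⟨m - i - 1, by omega⟩
    rw [ht] at h2 h3 h4
    obtain ⟨p1, p2, p3⟩ := hT.prev _ h1 t h2
    have ht' : m - 1 - i = t := by omega
    have ht'' : m - (i + 1) = t := by omega
    refine Run.setNat_seq (Run.setNat_seq (Run.setNat ?_))
    simp only [eval, eval_smul, f0, ← hm, hi', ht', ht'', f14, f12,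
      Memory.nat_setNat_apply]
    simp only [Nat.reduceEqDiff, false_and, if_false, true_and,
      and_self, if_true, hw t (by omega) _ p1]
    refine ⟨by omega, p3, fun g hg hg' => ?_, ?_⟩
    · split_ifs
      · exact p1
      · exact h3 g hg (by omega)
    · rw [sum_eq_sum_Ico_succ_bot (by omega), if_pos rfl, sum_congr rfl fun g hg => by
        rw [if_neg (by have := (mem_Ico.1 hg).1; omega : ¬ g = t)]]
      omega
  · rintro s' - ⟨h1, h2, h3, h4⟩
    -- Level `1` forces the remaining key to be `0`, so the collected weights add up to `x`.
    have h0 := hT.first _ h1 (by rw [h2]; omega)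
    rw [h0, Nat.sub_self] at h4
    refine ⟨fun g hg => h3 g hg (by omega), ?_⟩
    rw [key, range_eq_Ico]
    omega

end RAM

/-! ### Exhaustive search over keys, and the choice by the exceptional agent -/

namespace RAM

open NatExpr Program

/-! ### Evaluation of an allocation -/

theorem bundleSum_congr {m : ℕ} {A A' : ℕ → ℕ} (h : ∀ g < m, A g = A' g) (u : ℕ → ℝ) (k : ℕ) :
    bundleSum m A u k = bundleSum m A' u k := by
  unfold bundleSum
  rw [filter_congr fun g hg => by rw [h g (mem_range.1 hg)]]

theorem bundleCount_congr {m : ℕ} {A A' : ℕ → ℕ} (h : ∀ g < m, A g = A' g) (c : ℕ → ℕ)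
    (k j : ℕ) : bundleCount m A c k j = bundleCount m A' c k j := by
  unfold bundleCount
  rw [filter_congr fun g hg => by rw [h g (mem_range.1 hg)]]

/-- The labels `A` give an allocation that respects the quotas. -/
def RespectsQuotas (n ℓ m : ℕ) (c lo hi A : ℕ → ℕ) : Prop :=
  ∀ k < n, ∀ j < ℓ, lo j ≤ bundleCount m A c k j ∧ bundleCount m A c k j ≤ hi j

theorem RespectsQuotas.congr {n ℓ m : ℕ} {c lo hi A A' : ℕ → ℕ}
    (hA : RespectsQuotas n ℓ m c lo hi A) (h : ∀ g < m, A g = A' g) :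
    RespectsQuotas n ℓ m c lo hi A' := fun k hk j hj => by
  rw [← bundleCount_congr h]; exact hA k hk j hj

/-- Set the variable `17` to `1` if and only if the labels in the array `15` respect the quotas,
and store the least value of a bundle in the cell `4`. -/
def evalProg (n ℓ U : ℕ) : Program :=
  .setNat 17 (.const 0) (.const 1) ⨟
  .forRange 24 (.const n)
    (.forRange 22 (.const ℓ) (countProg ⨟
      .ite (.and (.natLe (.read 2 (.var 22)) (.var 16)) (.natLe (.var 16) (.read 3 (.var 22))))
        .skip (.setNat 17 (.const 0) (.const 0))) ⨟
    sumProg 15 U ⨟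
    .ite (.and (.natLe (.const 1) (.var 24)) (.realLe (.read 0 (.const 4)) (.read 0 (.const 1))))
      .skip (.setReal 0 (.const 4) (.read 0 (.const 1))))

theorem run_evalProg {n ℓ U N : ℕ} {s : Memory} (hn : 0 < n) (hmN : s.nat 0 0 ≤ N) (hnN : n ≤ N)
    (hℓN : ℓ ≤ N) :
    Run N (evalProg n ℓ (U + 1)) s fun s' =>
      (s'.nat 17 0 = 1 ↔
        RespectsQuotas n ℓ (s.nat 0 0) (s.nat 1) (s.nat 2) (s.nat 3) (s.nat 15)) ∧
      (∀ k < n, s'.real 0 4 ≤ bundleSum (s.nat 0 0) (s.nat 15) (s.real (U + 1)) k) ∧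
      ∃ k < n, bundleSum (s.nat 0 0) (s.nat 15) (s.real (U + 1)) k = s'.real 0 4 := by
  refine Run.setNat_seq ((Run.forRange (fun i s' =>
    (s'.nat 17 0 = 1 ↔
      RespectsQuotas i ℓ (s.nat 0 0) (s.nat 1) (s.nat 2) (s.nat 3) (s.nat 15)) ∧
    (∀ k < i, s'.real 0 4 ≤ bundleSum (s.nat 0 0) (s.nat 15) (s.real (U + 1)) k) ∧
    (0 < i → ∃ k < i, bundleSum (s.nat 0 0) (s.nat 15) (s.real (U + 1)) k = s'.real 0 4))
    n hnN rfl (fun _ _ => rfl) ?_ ?_).imp ?_)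
  · simp [RespectsQuotas]
  · rintro k s' hk hf hk' ⟨h1, h2, h3⟩
    have f0 : s'.nat 0 = s.nat 0 := by rw [hf.nat 0 rfl]; rfl
    have f1 : s'.nat 1 = s.nat 1 := by rw [hf.nat 1 rfl]; rfl
    have f2 : s'.nat 2 = s.nat 2 := by rw [hf.nat 2 rfl]; rfl
    have f3 : s'.nat 3 = s.nat 3 := by rw [hf.nat 3 rfl]; rfl
    have f15 : s'.nat 15 = s.nat 15 := by rw [hf.nat 15 rfl]; rfl
    have fU : s'.real (U + 1) = s.real (U + 1) := by rw [hf.real rfl]; rfl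
    refine Run.seq (Run.forRange (fun i s'' => s''.nat 17 0 = 1 ↔
      RespectsQuotas k ℓ (s.nat 0 0) (s.nat 1) (s.nat 2) (s.nat 3) (s.nat 15) ∧
      ∀ j < i, s.nat 2 j ≤ bundleCount (s.nat 0 0) (s.nat 15) (s.nat 1) k j ∧
        bundleCount (s.nat 0 0) (s.nat 15) (s.nat 1) k j ≤ s.nat 3 j) ℓ hℓN rfl
      (fun _ _ => rfl) (by simp [h1]) ?_) ?_
    · rintro j s'' hj hf' hj' h4
      refine Run.seq (run_countProg (by rw [hf'.nat 0 rfl, f0]; exact hmN)) fun s₃ hf₃ h₃ => ?_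
      rw [hf'.nat 0 rfl, hf'.nat 15 rfl, hf'.nat 1 rfl, hf'.nat 24 rfl, f0, f15, f1, hk', hj'] at h₃
      have e17 := hf₃.nat 17 rfl
      have e2 : s₃.nat 2 = s.nat 2 := by rw [hf₃.nat 2 rfl, hf'.nat 2 rfl, f2]
      have e3 : s₃.nat 3 = s.nat 3 := by rw [hf₃.nat 3 rfl, hf'.nat 3 rfl, f3]
      have e22 : s₃.nat 22 0 = j := by rw [hf₃.nat 22 rfl, hj']
      refine Run.ite (fun hb => Run.skip ?_) fun hb => Run.setNat ?_ <;>
        simp only [Test.Holds, eval, e2, e3, h₃, e22] at hb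
      · simp only [Nat.forall_lt_succ_right]
        simp [e17, h4, hb]
      · simp only [Nat.forall_lt_succ_right]
        simp [hb]
    · intro s₂ hf₂ h4
      have g15 : s₂.nat 15 = s.nat 15 := by rw [hf₂.nat 15 rfl, f15]
      have g0 : s₂.nat 0 = s.nat 0 := by rw [hf₂.nat 0 rfl, f0]
      have gU : s₂.real (U + 1) = s.real (U + 1) := by rw [hf₂.real rfl, fU]
      have g24 : s₂.nat 24 0 = k := by rw [hf₂.nat 24 rfl, hk']
      refine Run.seq (run_sumProg 15 U (by decide) (by rw [g0]; exact hmN)) fun s₃ hf₃ h₃ => ?_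
      rw [g15, g0, gU, g24] at h₃
      have e17 := hf₃.nat 17 rfl
      have e24 : s₃.nat 24 0 = k := by rw [hf₃.nat 24 rfl, g24]
      have e4 : s₃.real 0 4 = s'.real 0 4 := by rw [hf₃.cell rfl 4 rfl, hf₂.cell rfl 4 rfl]
      have hq : (s₃.nat 17 0 = 1 ↔
          RespectsQuotas (k + 1) ℓ (s.nat 0 0) (s.nat 1) (s.nat 2) (s.nat 3) (s.nat 15)) := by
        simp only [e17, h4, RespectsQuotas, Nat.forall_lt_succ_right]
      -- The guard on the label makes the first bundle overwrite whatever cell `4` contained before.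
      refine Run.ite (fun hb => Run.skip ?_) fun hb => Run.setReal ?_ <;>
        simp only [Test.Holds, RealExpr.eval, eval, e24, e4, h₃] at hb
      · simp only [Nat.forall_lt_succ_right, Memory.real_setNat, e4]
        refine ⟨by simpa using hq, ⟨h2, hb.2⟩, fun _ => ?_⟩
        obtain ⟨k', hk', h'⟩ := h3 hb.1
        exact ⟨k', by omega, h'⟩
      · simp only [Nat.forall_lt_succ_right, Memory.real_setNat, Memory.real_setReal_apply, eval,
          RealExpr.eval, h₃]
        refine ⟨by simpa using hq, ⟨fun k' hk' => ?_, by simp⟩, fun _ => ⟨k, by omega, by simp⟩⟩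
        have : bundleSum (s.nat 0 0) (s.nat 15) (s.real (U + 1)) k < s'.real 0 4 := by
          by_contra hlt
          exact hb ⟨by omega, not_lt.1 hlt⟩
        simpa using this.le.trans (h2 k' hk')
  · rintro s' - ⟨h1, h2, h3⟩
    exact ⟨h1, h2, h3 hn⟩

/-! ### Search for the best allocation -/

/-- If the variable `18` is `1`, then the array `4` describes an allocation that respects the
quotas, and its bundles have at least the value in the cell `5`. -/
def IsBest (n ℓ m : ℕ) (c lo hi : ℕ → ℕ) (u : ℕ → ℝ) (s : Memory) : Prop :=
  s.nat 18 0 = 1 → (∀ g < m, s.nat 4 g < n) ∧ RespectsQuotas n ℓ m c lo hi (s.nat 4) ∧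
    ∀ k < n, s.real 0 5 ≤ bundleSum m (s.nat 4) u k

/-- If `A` respects the quotas, then an allocation has been found that is at least as good. -/
def Dominates (n ℓ m : ℕ) (c lo hi : ℕ → ℕ) (u : ℕ → ℝ) (A : ℕ → ℕ) (s : Memory) : Prop :=
  RespectsQuotas n ℓ m c lo hi A → s.nat 18 0 = 1 ∧ ∃ k < n, bundleSum m A u k ≤ s.real 0 5

/-- The best allocation found so far has not become worse. -/
def Improves (s s' : Memory) : Prop :=
  s.nat 18 0 = 1 → s'.nat 18 0 = 1 ∧ s.real 0 5 ≤ s'.real 0 5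

theorem Improves.trans {s₁ s₂ s₃ : Memory} (h : Improves s₁ s₂) (h' : Improves s₂ s₃) :
    Improves s₁ s₃ := fun h1 => ⟨(h' (h h1).1).1, (h h1).2.trans (h' (h h1).1).2⟩

theorem improves_of_eq {s s' : Memory} (h : s'.nat 18 = s.nat 18)
    (h' : s'.real 0 5 = s.real 0 5) : Improves s s' := fun h1 => ⟨h ▸ h1, h'.ge⟩

section

variable {n ℓ m : ℕ} {c lo hi : ℕ → ℕ} {u : ℕ → ℝ}

theorem Dominates.improve {A : ℕ → ℕ} {s s' : Memory} (h : Dominates n ℓ m c lo hi u A s)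
    (h' : Improves s s') : Dominates n ℓ m c lo hi u A s' := fun hA => by
  obtain ⟨h1, k, hk, h2⟩ := h hA
  exact ⟨(h' h1).1, k, hk, h2.trans (h' h1).2⟩

theorem IsBest.congr {s s' : Memory} (hs : IsBest n ℓ m c lo hi u s) (h : s'.nat 18 = s.nat 18)
    (h₄ : s'.nat 4 = s.nat 4) (h₅ : s'.real 0 5 = s.real 0 5) :
    IsBest n ℓ m c lo hi u s' := by
  unfold IsBest
  rw [h, h₄, h₅]
  exact hs

end

/-- Evaluate the allocation in the array `15`, and store it if it is the best so far. -/
def tryProg (n ℓ U : ℕ) : Program :=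
  evalProg n ℓ U ⨟
  .ite (.and (.natEq (.var 17) (.const 1)) (.not (.and (.natEq (.var 18) (.const 1))
      (.realLe (.read 0 (.const 4)) (.read 0 (.const 5))))))
    (.setNat 18 (.const 0) (.const 1) ⨟
      .setReal 0 (.const 5) (.read 0 (.const 4)) ⨟
      .forRange 23 (.var 0) (.setNat 4 (.var 23) (.read 15 (.var 23))))
    .skip

/-- If the candidate respects the quotas, it is either stored or already matched by the stored one.
In both cases its poorest bundle witnesses the domination. -/
theorem run_tryProg {n ℓ U N : ℕ} {s : Memory} (hn : 0 < n) (hmN : s.nat 0 0 ≤ N) (hnN : n ≤ N)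
    (hℓN : ℓ ≤ N) (hA : ∀ g < s.nat 0 0, s.nat 15 g < n)
    (hs : IsBest n ℓ (s.nat 0 0) (s.nat 1) (s.nat 2) (s.nat 3) (s.real (U + 1)) s) :
    Run N (tryProg n ℓ (U + 1)) s fun s' =>
      IsBest n ℓ (s.nat 0 0) (s.nat 1) (s.nat 2) (s.nat 3) (s.real (U + 1)) s' ∧ Improves s s' ∧
      Dominates n ℓ (s.nat 0 0) (s.nat 1) (s.nat 2) (s.nat 3) (s.real (U + 1)) (s.nat 15) s' := by
  refine Run.seq (run_evalProg hn hmN hnN hℓN) ?_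
  rintro s₁ hf₁ ⟨h1, h2, k, hk, h3⟩
  have e18 := hf₁.nat 18 rfl
  have e5 := hf₁.cell rfl 5 rfl
  have e4 := hf₁.nat 4 rfl
  refine Run.ite (fun hb => Run.setNat_seq (Run.setReal_seq ?_)) fun hb => Run.skip ?_
  · simp only [Test.Holds, RealExpr.eval, eval, e18, e5, ← le_antisymm_iff, h1] at hb
    refine (Run.forRange (fun i s' => ∀ g < i, s'.nat 4 g = s.nat 15 g) (s.nat 0 0) hmN rfl
      (fun s' hf => by simp [hf.nat 0 rfl, hf₁.nat 0 rfl]) (by simp) ?_).imp ?_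
    · intro i s' hi hf hi' hs'
      refine Run.setNat fun g hg => ?_
      have : s'.nat 15 = s.nat 15 := by rw [hf.nat 15 rfl]; exact hf₁.nat 15 rfl
      simp only [eval, hi', this, Memory.nat_setNat_apply, (by decide : ¬ 4 = 23), false_and,
        if_false, true_and]
      split_ifs with h
      · rw [h]
      · exact hs' g (by omega)
    · intro s' hf hs'
      have g18 : s'.nat 18 0 = 1 := by rw [hf.nat 18 rfl]; simp
      have g5 : s'.real 0 5 = s₁.real 0 4 := by rw [hf.cell rfl 5 rfl]; simp
      refine ⟨fun _ => ⟨fun g hg => by rw [hs' g hg]; exact hA g hg,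
        hb.1.congr fun g hg => (hs' g hg).symm, fun k hk => ?_⟩, fun h => ⟨g18, ?_⟩,
        fun _ => ⟨g18, k, hk, by rw [h3, g5]⟩⟩
      · rw [bundleSum_congr hs', g5]
        exact h2 k hk
      · rw [g5]
        by_contra hlt
        exact hb.2 ⟨h, (not_le.1 hlt).le⟩
  · simp only [Test.Holds, RealExpr.eval, eval, e18, e5, ← le_antisymm_iff, h1] at hb
    refine ⟨hs.congr e18 e4 e5, improves_of_eq e18 e5, fun hq => ?_⟩
    have := not_not.1 (not_and.1 hb hq)
    exact ⟨by rw [e18]; exact this.1, k, hk, by rw [h3, e5]; exact this.2⟩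

/-- Try an allocation for every key, with the item in the variable `19` as unit of the values. -/
def scanProg (n ℓ U : ℕ) : Program :=
  weightProg n ℓ U ⨟ tableProg n ⨟
  .forRange 29 (.var 11) (.ite (.natEq (.read 13 (.var 29)) (.add (.var 0) (.const 1)))
    (traceProg n ⨟ tryProg n ℓ U) .skip)

/-- Tracing need not return a given `A`, only some `A'` with the same key. This suffices because the
key determines all counts and rounded values. -/
theorem run_scanProg {n ℓ U k N : ℕ} {s : Memory} (hn : 0 < n) (hp : Params n ℓ k s)
    (hN : tableSize n ℓ (s.nat 0 0) k + k + n + ℓ + 1 ≤ N) (hc : ∀ g < s.nat 0 0, s.nat 1 g < ℓ)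
    (hs : IsBest n ℓ (s.nat 0 0) (s.nat 1) (s.nat 2) (s.nat 3) (s.real (U + 1)) s) :
    Run N (scanProg n ℓ (U + 1)) s fun s' =>
      IsBest n ℓ (s.nat 0 0) (s.nat 1) (s.nat 2) (s.nat 3) (s.real (U + 1)) s' ∧ Improves s s' ∧
      ∃ r : ℕ → ℕ, (∀ g < s.nat 0 0, IsRound (s.nat 0 0 * k) (s.nat 0 0 * (s.nat 0 0 * k))
        |s.real (U + 1) (s.nat 19 0)| |s.real (U + 1) g| (r g)) ∧
      ∀ A : ℕ → ℕ, (∀ g < s.nat 0 0, A g < n) → ∃ A' : ℕ → ℕ, (∀ g < s.nat 0 0, A' g < n) ∧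
        key (weight n ℓ (digitBase (s.nat 0 0) k) (s.nat 1) r) A (s.nat 0 0) =
          key (weight n ℓ (digitBase (s.nat 0 0) k) (s.nat 1) r) A' (s.nat 0 0) ∧
        Dominates n ℓ (s.nat 0 0) (s.nat 1) (s.nat 2) (s.nat 3) (s.real (U + 1)) A' s' := by
  have hmN := lt_tableSize n ℓ (s.nat 0 0) k
  refine Run.seq (run_weightProg hn hp hN hc) ?_
  rintro s₁ hf₁ ⟨r, hr, hw₁⟩
  set D := weight n ℓ (digitBase (s.nat 0 0) k) (s.nat 1) r with hDdef
  have hD : GoodWeights n (s.nat 0 0) (tableSize n ℓ (s.nat 0 0) k) D :=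
    goodWeights_weight hc fun g hg => (hr g hg).le_cap
  have e0 := hf₁.nat 0 rfl
  have e11 := hf₁.nat 11 rfl
  refine Run.seq (run_tableProg (by rw [e0]; exact hD) (by rw [e11]; exact hp.size) (by omega)
    (by omega) (by omega) (by rw [e0]; exact hw₁)) ?_
  rintro s₂ hf₂ ⟨hT, hC⟩
  rw [e0] at hT hC
  have f (a : ℕ) (h1 : writesNat a (weightProg n ℓ (U + 1)) = false)
      (h2 : writesNat a (tableProg n) = false) : s₂.nat a = s.nat a := by
    rw [hf₂.nat a h2, hf₁.nat a h1]
  have fU : s₂.real (U + 1) = s.real (U + 1) := by rw [hf₂.real rfl, hf₁.real rfl]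
  have f5 : s₂.real 0 5 = s.real 0 5 := by rw [hf₂.cell rfl 5 rfl, hf₁.cell rfl 5 rfl]
  have f12 := hf₂.nat 12 rfl
  set m := s.nat 0 0 with hm
  refine (Run.forRange (fun x s' =>
    IsBest n ℓ m (s.nat 1) (s.nat 2) (s.nat 3) (s.real (U + 1)) s' ∧ Improves s s' ∧
    ∀ y < x, s₂.nat 13 y = m + 1 → ∃ A' : ℕ → ℕ, (∀ g < m, A' g < n) ∧ key D A' m = y ∧
      Dominates n ℓ m (s.nat 1) (s.nat 2) (s.nat 3) (s.real (U + 1)) A' s')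
    (tableSize n ℓ m k) (by omega) rfl
    (fun s' hf => by simp [hf.nat 11 rfl, f 11 rfl rfl, hp.size, hm]) ?_ ?_).imp ?_
  · refine ⟨hs.congr ?_ ?_ ?_, improves_of_eq ?_ ?_, by simp⟩ <;> simp [f5]
    · exact f 18 rfl rfl
    · exact f 4 rfl rfl
    · exact f 18 rfl rfl
  · rintro x s' hx hf hx' ⟨h1, h2, h3⟩
    have g0 : s'.nat 0 = s.nat 0 := by rw [hf.nat 0 rfl, f 0 rfl rfl]
    have g1 : s'.nat 1 = s.nat 1 := by rw [hf.nat 1 rfl, f 1 rfl rfl]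
    have g2 : s'.nat 2 = s.nat 2 := by rw [hf.nat 2 rfl, f 2 rfl rfl]
    have g3 : s'.nat 3 = s.nat 3 := by rw [hf.nat 3 rfl, f 3 rfl rfl]
    have g13 : s'.nat 13 = s₂.nat 13 := hf.nat 13 rfl
    have g14 : s'.nat 14 = s₂.nat 14 := hf.nat 14 rfl
    have g12 : s'.nat 12 = s₁.nat 12 := by rw [hf.nat 12 rfl, f12]
    have gU : s'.real (U + 1) = s.real (U + 1) := by rw [hf.real rfl, fU]
    refine Run.ite (fun hb => ?_) fun hb => Run.skip ?_
    · simp only [Test.Holds, eval, hx', g13, g0, ← le_antisymm_iff] at hb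
      refine Run.seq (run_traceProg (D := D) (by rw [g0, g13, g14]; exact hT)
        (by rw [g0]; omega) hx (by rw [g12, g0]; exact hw₁) hx' (by rw [g13, g0]; exact hb)) ?_
      rintro s₃ hf₃ ⟨h4, h5⟩
      rw [g0, ← hm] at h4 h5
      have k0 : s₃.nat 0 0 = m := by rw [hf₃.nat 0 rfl, g0]
      have k1 : s₃.nat 1 = s.nat 1 := by rw [hf₃.nat 1 rfl, g1]
      have k2 : s₃.nat 2 = s.nat 2 := by rw [hf₃.nat 2 rfl, g2]
      have k3 : s₃.nat 3 = s.nat 3 := by rw [hf₃.nat 3 rfl, g3]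
      have kU : s₃.real (U + 1) = s.real (U + 1) := by rw [hf₃.real rfl, gU]
      have hB := h1.congr (hf₃.nat 18 rfl) (hf₃.nat 4 rfl) (hf₃.cell rfl 5 rfl)
      refine (run_tryProg (U := U) hn (by omega) (by omega) (by omega) (by rw [k0]; exact h4)
        (by rw [k0, k1, k2, k3, kU]; exact hB)).imp ?_
      rintro s₄ - ⟨h6, h7, h8⟩
      rw [k0, k1, k2, k3, kU] at h6 h8
      have hI : Improves s' s₄ := (improves_of_eq (hf₃.nat 18 rfl) (hf₃.cell rfl 5 rfl)).trans h7
      have hI' : Improves s₄ (s₄.setNat 29 0 (x + 1)) := improves_of_eq (by simp) (by simp)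
      refine ⟨h6.congr (by simp) (by simp) (by simp), (h2.trans hI).trans hI', fun y hy hy' => ?_⟩
      rcases Nat.lt_or_ge y x with h | h
      · obtain ⟨A', hA', hk', hd⟩ := h3 y h hy'
        exact ⟨A', hA', hk', hd.improve (hI.trans hI')⟩
      · obtain rfl : y = x := by omega
        exact ⟨s₃.nat 15, h4, h5, h8.improve hI'⟩
    · simp only [Test.Holds, eval, hx', g13, g0, ← le_antisymm_iff] at hb
      have hI : Improves s' (s'.setNat 29 0 (x + 1)) := improves_of_eq (by simp) (by simp)
      refine ⟨h1.congr (by simp) (by simp) (by simp), h2.trans hI, fun y hy hy' => ?_⟩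
      rcases Nat.lt_or_ge y x with h | h
      · obtain ⟨A', hA', hk', hd⟩ := h3 y h hy'
        exact ⟨A', hA', hk', hd.improve hI⟩
      · obtain rfl : y = x := by omega
        exact absurd hy' hb
  · rintro s' - ⟨h1, h2, h3⟩
    refine ⟨h1, h2, r, hr, fun A hA => ?_⟩
    obtain ⟨A', hA', hk', hd⟩ := h3 (key D A m) (hD.lt A m le_rfl hA) (hC A hA)
    exact ⟨A', hA', hk'.symm, hd⟩

/-- Find an approximately optimal allocation. -/
def searchProg (n ℓ U : ℕ) : Program :=
  setupProg n ℓ ⨟ .setNat 18 (.const 0) (.const 0) ⨟ .forRange 19 (.var 0) (scanProg n ℓ U)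

/-- The suitable unit depends on an unknown optimal allocation, so every item `w` is tried. Results
for earlier units survive because the stored allocation never becomes worse. -/
theorem run_searchProg {n ℓ U N₀ N : ℕ} {s : Memory} (hn : 0 < n) (hs : 0 ≤ s.real 0 0)
    (hN₀ : 1 ≤ N₀ * s.real 0 0)
    (hN : ∀ k ≤ N₀ + 1, tableSize n ℓ (s.nat 0 0) k + k + n + ℓ + 1 ≤ N)
    (hc : ∀ g < s.nat 0 0, s.nat 1 g < ℓ) :
    Run N (searchProg n ℓ (U + 1)) s fun s' =>
      IsBest n ℓ (s.nat 0 0) (s.nat 1) (s.nat 2) (s.nat 3) (s.real (U + 1)) s' ∧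
      ∃ k : ℕ, 1 ≤ k ∧ 1 ≤ k * s.real 0 0 ∧ ∀ w < s.nat 0 0, ∃ r : ℕ → ℕ,
      (∀ g < s.nat 0 0, IsRound (s.nat 0 0 * k) (s.nat 0 0 * (s.nat 0 0 * k))
        |s.real (U + 1) w| |s.real (U + 1) g| (r g)) ∧
      ∀ A : ℕ → ℕ, (∀ g < s.nat 0 0, A g < n) → ∃ A' : ℕ → ℕ, (∀ g < s.nat 0 0, A' g < n) ∧
        key (weight n ℓ (digitBase (s.nat 0 0) k) (s.nat 1) r) A (s.nat 0 0) =
          key (weight n ℓ (digitBase (s.nat 0 0) k) (s.nat 1) r) A' (s.nat 0 0) ∧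
        Dominates n ℓ (s.nat 0 0) (s.nat 1) (s.nat 2) (s.nat 3) (s.real (U + 1)) A' s' := by
  refine Run.seq (run_setupProg hn hs hN₀ hN) ?_
  rintro s₁ hf₁ ⟨k, hk₁, hk₂, hk₃, hp⟩
  have hNk := hN k hk₃
  have hmN := lt_tableSize n ℓ (s.nat 0 0) k
  refine Run.setNat_seq ?_
  set m := s.nat 0 0 with hm
  set s₂ := s₁.setNat 18 _ _ with hs₂
  have f (a : ℕ) (h : a ≠ 18) (h' : writesNat a (setupProg n ℓ) = false) :
      s₂.nat a = s.nat a := by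
    rw [hs₂, Memory.nat_setNat_of_ne _ _ _ _ _ h, hf₁.nat a h']
  have fU : s₂.real (U + 1) = s.real (U + 1) := by rw [hs₂]; exact hf₁.real rfl U
  have f18 : s₂.nat 18 0 = 0 := by simp [hs₂]
  have hp₂ : Params n ℓ k s₂ := hp.congr fun a ha => by
    rw [hs₂, Memory.nat_setNat_of_ne _ _ _ _ _ (by rintro rfl; simp at ha)]
  clear_value s₂
  refine (Run.forRange (fun i s' =>
      IsBest n ℓ m (s.nat 1) (s.nat 2) (s.nat 3) (s.real (U + 1)) s' ∧ ∀ w < i, ∃ r : ℕ → ℕ,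
      (∀ g < m, IsRound (m * k) (m * (m * k)) |s.real (U + 1) w| |s.real (U + 1) g| (r g)) ∧
      ∀ A : ℕ → ℕ, (∀ g < m, A g < n) → ∃ A' : ℕ → ℕ, (∀ g < m, A' g < n) ∧
        key (weight n ℓ (digitBase m k) (s.nat 1) r) A m =
          key (weight n ℓ (digitBase m k) (s.nat 1) r) A' m ∧
        Dominates n ℓ m (s.nat 1) (s.nat 2) (s.nat 3) (s.real (U + 1)) A' s')
    m (by omega) rfl (fun s' hf => by simp [hf.nat 0 rfl, f 0 (by decide) rfl, hm]) ?_ ?_).imp ?_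
  -- The flag in variable `18` is `0`, so nothing is claimed about the stored allocation yet.
  · refine ⟨fun h => ?_, by simp⟩
    simp [f18] at h
  · rintro i s' hi hf hi' ⟨h1, h2⟩
    have g0 : s'.nat 0 0 = m := by rw [hf.nat 0 rfl, f 0 (by decide) rfl]
    have g1 : s'.nat 1 = s.nat 1 := by rw [hf.nat 1 rfl, f 1 (by decide) rfl]
    have g2 : s'.nat 2 = s.nat 2 := by rw [hf.nat 2 rfl, f 2 (by decide) rfl]
    have g3 : s'.nat 3 = s.nat 3 := by rw [hf.nat 3 rfl, f 3 (by decide) rfl]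
    have gU : s'.real (U + 1) = s.real (U + 1) := by rw [hf.real rfl, fU]
    have gp : Params n ℓ k s' := hp₂.congr fun a ha => by
      simp only [List.mem_cons, List.not_mem_nil, or_false] at ha
      rcases ha with rfl | rfl | rfl | rfl | rfl | rfl <;> exact hf.nat _ rfl
    refine (run_scanProg (U := U) hn gp (by rw [g0]; exact hNk) (by rw [g0, g1]; exact hc)
      (by rw [g0, g1, g2, g3, gU]; exact h1)).imp ?_
    rintro s₃ - ⟨h3, h4, h5⟩
    rw [g0, g1, g2, g3, gU] at h3 h5
    rw [hi'] at h5
    have hI : Improves s₃ (s₃.setNat 19 0 (i + 1)) := improves_of_eq (by simp) (by simp)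
    refine ⟨h3.congr (by simp) (by simp) (by simp), fun w hw => ?_⟩
    obtain ⟨r, hr, h⟩ : ∃ r : ℕ → ℕ, (∀ g < m, IsRound (m * k) (m * (m * k))
        |s.real (U + 1) w| |s.real (U + 1) g| (r g)) ∧
        ∀ A : ℕ → ℕ, (∀ g < m, A g < n) → ∃ A' : ℕ → ℕ, (∀ g < m, A' g < n) ∧
        key (weight n ℓ (digitBase m k) (s.nat 1) r) A m =
          key (weight n ℓ (digitBase m k) (s.nat 1) r) A' m ∧
        Dominates n ℓ m (s.nat 1) (s.nat 2) (s.nat 3) (s.real (U + 1)) A' s₃ := by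
      rcases Nat.lt_or_ge w i with h | h
      · obtain ⟨r, hr, h⟩ := h2 w h
        refine ⟨r, hr, fun A hA => ?_⟩
        obtain ⟨A', hA', hk', hd⟩ := h A hA
        exact ⟨A', hA', hk', hd.improve h4⟩
      · obtain rfl : w = i := by omega
        exact h5
    refine ⟨r, hr, fun A hA => ?_⟩
    obtain ⟨A', hA', hk', hd⟩ := h A hA
    exact ⟨A', hA', hk', hd.improve hI⟩
  · rintro s' - ⟨h1, h2⟩
    exact ⟨h1, k, hk₁, hk₂, h2⟩

/-! ### The choice of the exceptional agent -/

/-- Swap the label `e` and the label of the best bundle in terms of the array `V`. -/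
def chooseProg (n e V : ℕ) : Program :=
  .forRange 24 (.const n) (sumProg 4 V ⨟
    .ite (.and (.natLe (.const 1) (.var 24)) (.realLe (.read 0 (.const 1)) (.read 0 (.const 4))))
      .skip (.setReal 0 (.const 4) (.read 0 (.const 1)) ⨟ .setNat 32 (.const 0) (.var 24))) ⨟
  .forRange 23 (.var 0) (.ite (.natEq (.read 4 (.var 23)) (.var 32))
    (.setNat 4 (.var 23) (.const e))
    (.ite (.natEq (.read 4 (.var 23)) (.const e)) (.setNat 4 (.var 23) (.var 32)) .skip))

theorem run_chooseProg {n e V N : ℕ} {s : Memory} (hn : 0 < n) (hmN : s.nat 0 0 ≤ N)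
    (hnN : n ≤ N) :
    Run N (chooseProg n e (V + 1)) s fun s' => ∃ b < n,
      (∀ k < n, bundleSum (s.nat 0 0) (s.nat 4) (s.real (V + 1)) k ≤
        bundleSum (s.nat 0 0) (s.nat 4) (s.real (V + 1)) b) ∧
      ∀ g < s.nat 0 0, s'.nat 4 g = Equiv.swap b e (s.nat 4 g) := by
  refine Run.seq (Run.forRange (fun i s' =>
    (∀ k < i, bundleSum (s.nat 0 0) (s.nat 4) (s.real (V + 1)) k ≤ s'.real 0 4) ∧
    (0 < i → s'.nat 32 0 < i ∧
      s'.real 0 4 = bundleSum (s.nat 0 0) (s.nat 4) (s.real (V + 1)) (s'.nat 32 0)))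
    n hnN rfl (fun _ _ => rfl) (by simp) ?_) ?_
  · rintro k s' hk hf hk' ⟨h1, h2⟩
    have g4 : s'.nat 4 = s.nat 4 := hf.nat 4 rfl
    have g0 : s'.nat 0 = s.nat 0 := hf.nat 0 rfl
    have gV : s'.real (V + 1) = s.real (V + 1) := hf.real rfl V
    refine Run.seq (run_sumProg 4 V (by decide) (by rw [g0]; exact hmN)) fun s₃ hf₃ h₃ => ?_
    rw [g4, g0, gV, hk'] at h₃
    have e24 : s₃.nat 24 0 = k := by rw [hf₃.nat 24 rfl, hk']
    have e4 : s₃.real 0 4 = s'.real 0 4 := hf₃.cell rfl 4 rfl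
    have e32 : s₃.nat 32 = s'.nat 32 := hf₃.nat 32 rfl
    refine Run.ite (fun hb => Run.skip ?_) fun hb => Run.setReal_seq (Run.setNat ?_) <;>
      simp only [Test.Holds, RealExpr.eval, eval, e24, e4, h₃] at hb <;>
      simp only [Nat.forall_lt_succ_right]
    · obtain ⟨h3, h4⟩ := h2 hb.1
      simp only [Memory.real_setNat, Memory.nat_setNat_of_ne _ _ _ _ _ (by decide : 32 ≠ 24), e4, e32]
      exact ⟨⟨h1, hb.2⟩, fun _ => ⟨by omega, h4⟩⟩
    · simp [h₃, e24]
      intro k' hk'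
      have : s'.real 0 4 < bundleSum (s.nat 0 0) (s.nat 4) (s.real (V + 1)) k := by
        by_contra hlt
        exact hb ⟨by omega, not_lt.1 hlt⟩
      exact (h1 k' hk').trans this.le
  · rintro s₁ hf₁ ⟨h1, h2⟩
    obtain ⟨h3, h4⟩ := h2 hn
    rw [h4] at h1
    set b := s₁.nat 32 0 with hb
    have e4 : s₁.nat 4 = s.nat 4 := hf₁.nat 4 rfl
    -- Relabelling is done in place; the second clause ensures that item `i` is still read with its
    -- old label.
    refine (Run.forRange (fun i s' => (∀ g < i, s'.nat 4 g = Equiv.swap b e (s.nat 4 g)) ∧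
      ∀ g, i ≤ g → s'.nat 4 g = s.nat 4 g) (s.nat 0 0) hmN rfl
      (fun s' hf => by simp [hf.nat 0 rfl, hf₁.nat 0 rfl]) (by simp [e4]) ?_).imp ?_
    · rintro i s' hi hf hi' ⟨h5, h6⟩
      have e32 : s'.nat 32 0 = b := by rw [hf.nat 32 rfl]
      have hii := h6 i le_rfl
      refine Run.ite (fun hb => Run.setNat ?_) fun hb => Run.ite (fun hb' => Run.setNat ?_)
        fun hb' => Run.skip ?_ <;>
        simp only [Test.Holds, eval, hi', hii, e32, ← le_antisymm_iff] at hb <;>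
        try simp only [Test.Holds, eval, hi', hii, ← le_antisymm_iff] at hb'
      all_goals
        simp only [eval, Memory.nat_setNat_apply, Nat.reduceEqDiff, false_and,
          if_false, true_and, hi', e32]
        refine ⟨fun g hg => ?_, fun g hg => ?_⟩
        · rcases Nat.lt_or_ge g i with h | h
          · simp [h.ne, h5 g h]
          · obtain rfl : g = i := by omega
            first
            | exact hii.trans (Equiv.swap_apply_of_ne_of_ne hb hb').symm
            | simp [*]
        · have : g ≠ i := by omega
          simp [this, h6 g (by omega)]
    · rintro s' - ⟨h5, -⟩
      exact ⟨b, h3, h1, h5⟩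

end RAM

/-! ### Error analysis of the rounding -/

namespace RAM

/-! ### The quality of the rounded values -/

section

variable {m k : ℕ} {a : ℝ} {x : ℕ → ℝ} {r : ℕ → ℕ} {S S' : Finset ℕ}

theorem sum_round_mul_le {Q K : ℕ} (hr : ∀ g ∈ S, IsRound Q K a (x g) (r g)) :
    (∑ g ∈ S, r g : ℕ) * a ≤ Q * ∑ g ∈ S, x g := by
  push_cast
  rw [sum_mul, mul_sum]
  exact sum_le_sum fun g hg => (hr g hg).le_quot

/-- Rounding down loses at most one unit per item, hence at most `m` units in total. -/
theorem le_sum_round_mul {Q : ℕ} (ha : 0 ≤ a) (hS : #S ≤ m)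
    (hr : ∀ g ∈ S, Q * x g ≤ (r g + 1) * a) :
    Q * ∑ g ∈ S, x g ≤ ((∑ g ∈ S, r g : ℕ) + m) * a := by
  calc Q * ∑ g ∈ S, x g ≤ ∑ g ∈ S, (r g + 1 : ℝ) * a := by
        rw [mul_sum]; exact sum_le_sum hr
    _ = ((∑ g ∈ S, r g : ℕ) + #S) * a := by
        rw [← sum_mul, sum_add_distrib]; simp
    _ ≤ _ := by gcongr

/-- Two sets with the same rounded value have almost the same value. -/
theorem sum_le_sum_add_div (hm : 0 < m) (hk : 0 < k) (ha : 0 ≤ a) (hS : #S ≤ m)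
    (h : ∑ g ∈ S, r g = ∑ g ∈ S', r g) (hr : ∀ g ∈ S, (m * k : ℕ) * x g ≤ (r g + 1) * a)
    (hr' : ∀ g ∈ S', IsRound (m * k) (m * (m * k)) a (x g) (r g)) :
    ∑ g ∈ S, x g ≤ ∑ g ∈ S', x g + a / k := by
  have h1 := le_sum_round_mul ha hS hr
  have h2 := sum_round_mul_le hr'
  rw [h] at h1
  have hmk : (0 : ℝ) < (m * k : ℕ) := by positivity
  refine le_of_mul_le_mul_left ?_ hmk
  -- For `Q = m * k`, a loss of `m` units of size `a / Q` is exactly `a / k`.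
  have h3 : ((m * k : ℕ) : ℝ) * (∑ g ∈ S', x g + a / k) =
      (m * k : ℕ) * ∑ g ∈ S', x g + m * a := by
    push_cast; field_simp
  rw [h3]
  linarith [add_mul ((∑ g ∈ S', r g : ℕ) : ℝ) m a]

/-- If `S` has a capped item, then every set with the same rounded value has a large value. -/
theorem cap_le_sum (hm : 0 < m) (hk : 0 < k) (ha : 0 ≤ a)
    (h : ∑ g ∈ S, r g = ∑ g ∈ S', r g) {g : ℕ} (hg : g ∈ S) (hrg : r g = m * (m * k))
    (hr' : ∀ g ∈ S', IsRound (m * k) (m * (m * k)) a (x g) (r g)) :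
    m * a ≤ ∑ g ∈ S', x g := by
  have h2 := sum_round_mul_le hr'
  rw [← h] at h2
  have h1 : m * (m * k) ≤ ∑ g ∈ S, r g := hrg ▸ single_le_sum (fun _ _ => Nat.zero_le _) hg
  have hmk : (0 : ℝ) < (m * k : ℕ) := by positivity
  refine le_of_mul_le_mul_left ?_ hmk
  calc ((m * k : ℕ) : ℝ) * (m * a) = (m * (m * k) : ℕ) * a := by push_cast; ring
    _ ≤ (∑ g ∈ S, r g : ℕ) * a := by gcongr
    _ ≤ _ := h2

end

section

variable {n m k : ℕ} {A A' r : ℕ → ℕ} {u : ℕ → ℝ} {w : ℕ}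

theorem card_filter_range_le (m : ℕ) (p : ℕ → Prop) [DecidablePred p] :
    #{g ∈ range m | p g} ≤ m := (card_filter_le _ _).trans (by simp)

/-- The two bounds on the unit serve the two cases: `μ ≤ m * u w` settles bundles with a capped item
through `cap_le_sum`, and `u w ≤ μ` turns the error `u w / k` of the other bundles into `μ / k`. -/
theorem bundleSum_goods_of_round (hm : 0 < m) (hk : 0 < k) (hu : ∀ g < m, 0 ≤ u g) (hw : w < m)
    (hr : ∀ g < m, IsRound (m * k) (m * (m * k)) |u w| |u g| (r g)) {i : ℕ}
    (hi : bundleRound m A r i = bundleRound m A' r i) {μ : ℝ} (hμ : μ ≤ bundleSum m A u i)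
    (hwμ : u w ≤ μ) (hμw : μ ≤ m * u w) : (1 - 1 / k) * μ ≤ bundleSum m A' u i := by
  have hr' : ∀ g < m, IsRound (m * k) (m * (m * k)) (u w) (u g) (r g) := fun g hg => by
    have := hr g hg
    rwa [abs_of_nonneg (hu w hw), abs_of_nonneg (hu g hg)] at this
  have hA' : ∀ g ∈ (range m).filter (A' · = i), IsRound (m * k) (m * (m * k)) (u w) (u g) (r g) :=
    fun g hg => hr' g (mem_range.1 (mem_filter.1 hg).1)
  have hμ0 : 0 ≤ μ := (hu w hw).trans hwμ
  by_cases hcap : ∃ g ∈ (range m).filter (A · = i), r g = m * (m * k)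
  · obtain ⟨g, hg, hrg⟩ := hcap
    have := cap_le_sum hm hk (hu w hw) hi hg hrg hA'
    refine le_trans ?_ (hμw.trans this)
    have : 0 ≤ 1 / (k : ℝ) * μ := by positivity
    linarith
  · push Not at hcap
    have := sum_le_sum_add_div hm hk (hu w hw) (card_filter_range_le m (A · = i)) hi
      (fun g hg => ((hr' g (mem_range.1 (mem_filter.1 hg).1)).quot_lt.resolve_left
        (hcap g hg)).le) hA'
    have h1 : μ ≤ bundleSum m A' u i + u w / k := hμ.trans this
    have h2 : u w / k ≤ μ / k := by gcongr
    have h3 : (1 - 1 / (k : ℝ)) * μ = μ - μ / k := by ring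
    linarith

/-- Applied to the burdens `-u`, the estimate of `sum_le_sum_add_div` is needed with `A'` on the
smaller side, so the roles of the allocations are exchanged. -/
theorem bundleSum_chores_of_round (hm : 0 < m) (hk : 0 < k) (hu : ∀ g < m, u g ≤ 0) (hw : w < m)
    (hw0 : u w < 0) (hmax : ∀ g < m, u w ≤ u g)
    (hr : ∀ g < m, IsRound (m * k) (m * (m * k)) |u w| |u g| (r g)) {i : ℕ}
    (hi : bundleRound m A r i = bundleRound m A' r i) :
    bundleSum m A u i + u w / k ≤ bundleSum m A' u i := by
  have hr' : ∀ g < m, IsRound (m * k) (m * (m * k)) (- u w) (- u g) (r g) := fun g hg => by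
    have := hr g hg
    rwa [abs_of_nonpos (hu w hw), abs_of_nonpos (hu g hg)] at this
  have := sum_le_sum_add_div (x := fun g => - u g) hm hk (by linarith : 0 ≤ - u w)
    (card_filter_range_le m (A' · = i)) hi.symm (fun g hg => ?_)
    (fun g hg => hr' g (mem_range.1 (mem_filter.1 hg).1))
  · simp only [sum_neg_distrib, neg_div] at this
    unfold bundleSum
    linarith
  · have hg' := mem_range.1 (mem_filter.1 hg).1
    -- The unit has the largest burden, so true quotients are at most `m * k`, which does not exceed
    -- the cap. Capping therefore loses nothing.
    rcases (hr' g hg').quot_lt with h | h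
    · have h1 : m * k ≤ m * (m * k) := Nat.le_mul_of_pos_left _ hm
      calc ((m * k : ℕ) : ℝ) * - u g ≤ (m * k : ℕ) * - u w := by
            have := hmax g hg'
            gcongr
        _ ≤ (r g + 1) * - u w := by
            have : ((m * k : ℕ) : ℝ) ≤ r g + 1 := by
              rw [h]; exact_mod_cast h1.trans (Nat.le_succ _)
            have h' : 0 ≤ - u w := by linarith
            gcongr
    · exact h.le

theorem sum_bundleSum (hA : ∀ g < m, A g < n) :
    ∑ k ∈ range n, bundleSum m A u k = ∑ g ∈ range m, u g := by
  unfold bundleSum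
  simp only [sum_filter]
  rw [sum_comm]
  refine sum_congr rfl fun g hg => ?_
  rw [sum_ite_eq, if_pos (mem_range.2 (hA g (mem_range.1 hg)))]

end

end RAM

/-! ### Labels, feasible allocations and maximin shares -/

namespace FDInstance

open RAM

variable {n ℓ m : ℕ}

/-! ### Allocations and labels -/

/-- The memory `s` holds the input `(I, ε)`. -/
structure Input (I : FDInstance n ℓ m) (ε : ℝ) (s : Memory) : Prop where
  items : s.nat 0 0 = m
  cat : ∀ g : Fin m, s.nat 1 g = I.cat g
  lo : ∀ j : Fin ℓ, s.nat 2 j = I.lo j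
  hi : ∀ j : Fin ℓ, s.nat 3 j = I.hi j
  accuracy : s.real 0 0 = ε
  val : ∀ (i : Fin n) (g : Fin m), s.real (i + 1) g = I.val i g

theorem input_initMemory (I : FDInstance n ℓ m) (ε : ℝ) : I.Input ε (I.initMemory ε) := by
  constructor <;> simp [initMemory]

theorem Input.congr {I : FDInstance n ℓ m} {ε : ℝ} {s s' : Memory} (h : I.Input ε s)
    (hnat : ∀ a < 4, s'.nat a = s.nat a) (hreal : s'.real = s.real) : I.Input ε s' := by
  obtain ⟨h1, h2, h3, h4, h5, h6⟩ := h
  constructor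
  · rwa [hnat 0 (by omega)]
  · rwa [hnat 1 (by omega)]
  · rwa [hnat 2 (by omega)]
  · rwa [hnat 3 (by omega)]
  · rwa [hreal]
  · rwa [hreal]

/-- The allocation given by labels. -/
def ofLabels (n m : ℕ) (A : ℕ → ℕ) : Fin n → Finset (Fin m) := fun i => {g | A g = i}

theorem exists_labels {P : Fin n → Finset (Fin m)} (hP : ∀ g, ∃! i, g ∈ P i) :
    ∃ A : ℕ → ℕ, (∀ g < m, A g < n) ∧ ofLabels n m A = P := by
  choose f hf hf' using hP
  refine ⟨fun g => if h : g < m then f ⟨g, h⟩ else 0, fun g hg => by simp [hg], ?_⟩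
  funext i
  ext g
  simp only [ofLabels, mem_filter, mem_univ, true_and, Fin.is_lt, dif_pos, Fin.eta, Fin.val_inj]
  exact ⟨fun h => h ▸ hf g, fun h => (hf' g i h).symm⟩

section

variable {I : FDInstance n ℓ m} {ε : ℝ} {s : Memory} {A : ℕ → ℕ}

theorem value_ofLabels (h : I.Input ε s) (i k : Fin n) :
    I.value i (ofLabels n m A k) = bundleSum m A (s.real (i + 1)) k := by
  unfold value bundleSum ofLabels
  rw [sum_filter, sum_filter, sum_range]
  exact sum_congr rfl fun g _ => by rw [h.val]

theorem card_ofLabels (h : I.Input ε s) (k : Fin n) (j : Fin ℓ) :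
    #{g ∈ ofLabels n m A k | I.cat g = j} = bundleCount m A (s.nat 1) k j := by
  unfold bundleCount ofLabels
  rw [filter_filter, card_filter, card_filter, sum_range]
  exact sum_congr rfl fun g _ => by simp only [h.cat, Fin.val_inj]

theorem feasibleAllocation_ofLabels (h : I.Input ε s) (hA : ∀ g < m, A g < n) :
    I.FeasibleAllocation (ofLabels n m A) ↔
      RespectsQuotas n ℓ m (s.nat 1) (s.nat 2) (s.nat 3) A := by
  constructor
  · rintro ⟨-, hq⟩ k hk j hj
    have := hq ⟨k, hk⟩ ⟨j, hj⟩
    rwa [card_ofLabels h, ← h.lo, ← h.hi] at this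
  · intro hq
    refine ⟨fun g => ⟨⟨A g, hA g g.2⟩, by simp [ofLabels], fun i hi => ?_⟩, fun k j => ?_⟩
    · simp only [ofLabels, mem_filter, mem_univ, true_and] at hi
      exact Fin.ext hi.symm
    · rw [card_ofLabels h, ← h.lo, ← h.hi]
      exact hq k k.2 j j.2

end

/-! ### Existence of feasible allocations -/

theorem card_filter_mod_bounds {c n lo hi k : ℕ} (h₁ : lo * n ≤ c) (h₂ : c ≤ hi * n) (hk : k < n) :
    lo ≤ #{r ∈ range c | r % n = k} ∧ #{r ∈ range c | r % n = k} ≤ hi := by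
  have hinj : Function.Injective fun q => n * q + k := fun q q' h => by
    have : n * q = n * q' := Nat.add_right_cancel h
    exact Nat.eq_of_mul_eq_mul_left (by omega) this
  constructor
  · calc lo = #((range lo).image fun q => n * q + k) := by
          rw [card_image_of_injective _ hinj, card_range]
      _ ≤ _ := card_le_card fun r hr => by
          obtain ⟨q, hq, rfl⟩ := mem_image.1 hr
          rw [mem_range] at hq
          rw [mem_filter, mem_range, Nat.mul_add_mod, Nat.mod_eq_of_lt hk]
          refine ⟨?_, rfl⟩
          calc n * q + k < n * (q + 1) := by rw [mul_add]; omega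
            _ ≤ n * lo := by gcongr; omega
            _ ≤ c := by rwa [mul_comm]
  · calc #{r ∈ range c | r % n = k} ≤ #((range hi).image fun q => n * q + k) :=
          card_le_card fun r hr => by
            rw [mem_filter, mem_range] at hr
            refine mem_image.2 ⟨r / n, ?_, by rw [← hr.2]; exact Nat.div_add_mod r n⟩
            rw [mem_range]
            exact Nat.div_lt_of_lt_mul (by rw [mul_comm]; omega)
      _ ≤ hi := card_image_le.trans (by simp)

/-- The items of each category are numbered and dealt out round-robin, modulo `n`. The quota
inequalities of the instance then bound every agent's share of each category. -/
theorem exists_feasibleAllocation (I : FDInstance n ℓ m) (hn : 0 < n) :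
    ∃ P, I.FeasibleAllocation P := by
  let C (j : Fin ℓ) : Finset (Fin m) := {g | I.cat g = j}
  have hC : ∀ g, g ∈ C (I.cat g) := fun g => by simp [C]
  let f (g : Fin m) : Fin n := ⟨(C (I.cat g)).equivFin ⟨g, hC g⟩ % n, Nat.mod_lt _ hn⟩
  refine ⟨fun i => {g | f g = i}, fun g => ⟨f g, by simp, fun i hi => (mem_filter.1 hi).2.symm⟩,
    fun k j => ?_⟩
  have : #{g ∈ ({g | f g = k} : Finset (Fin m)) | I.cat g = j} =
      #{r ∈ range #(C j) | r % n = k} := by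
    refine card_bij (fun g hg => (C j).equivFin ⟨g, ?_⟩) ?_ ?_ ?_
    · simp only [mem_filter] at hg
      simp [C, hg.2]
    · intro g hg
      simp only [mem_filter, mem_univ, true_and] at hg
      obtain ⟨h1, rfl⟩ := hg
      rw [mem_filter, mem_range]
      exact ⟨Fin.is_lt _, congrArg Fin.val h1⟩
    · intro g hg g' hg' h
      have := (C j).equivFin.injective (Fin.ext h)
      simpa using this
    · intro r hr
      rw [mem_filter, mem_range] at hr
      obtain ⟨⟨g, hg⟩, h⟩ := (C j).equivFin.surjective ⟨r, hr.1⟩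
      have hg' : I.cat g = j := by simpa [C] using hg
      subst hg'
      refine ⟨g, ?_, by rw [h]⟩
      simp only [mem_filter, mem_univ, true_and, and_true]
      refine Fin.ext ?_
      simp only [f]
      rw [h]
      exact hr.2
  rw [this]
  exact card_filter_mod_bounds (I.lo_mul_le j) (I.le_hi_mul j) k.2

/-- The maximin share is attained. -/
theorem exists_mms_eq (I : FDInstance n ℓ m) (hn : 0 < n) (i : Fin n) :
    ∃ P, I.FeasibleAllocation P ∧ (∀ k, I.mms i ≤ I.value i (P k)) ∧
      ∃ k, I.value i (P k) = I.mms i := by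
  have : Nonempty (Fin n) := ⟨⟨0, hn⟩⟩
  have hset : {x : ℝ | ∃ P : Fin n → Finset (Fin m), I.FeasibleAllocation P ∧
      x = ⨅ k : Fin n, I.value i (P k)} =
      (fun P : Fin n → Finset (Fin m) => ⨅ k : Fin n, I.value i (P k)) ''
        {P | I.FeasibleAllocation P} := by
    ext x
    simp only [Set.mem_ofPred_eq, Set.mem_image]
    exact exists_congr fun P => and_congr_right fun _ => eq_comm
  obtain ⟨P₀, hP₀⟩ := I.exists_feasibleAllocation hn
  have hmem : I.mms i ∈ (fun P : Fin n → Finset (Fin m) => ⨅ k : Fin n, I.value i (P k)) ''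
      {P | I.FeasibleAllocation P} := by
    unfold mms
    rw [hset]
    exact Set.Nonempty.csSup_mem ⟨_, P₀, hP₀, rfl⟩ (Set.toFinite _)
  obtain ⟨P, hP, h⟩ := hmem
  refine ⟨P, hP, fun k => ?_, ?_⟩
  · rw [← h]
    exact ciInf_le (Set.finite_range _).bddBelow k
  · obtain ⟨k, hk⟩ := exists_eq_ciInf_of_finite (f := fun k : Fin n => I.value i (P k))
    exact ⟨k, hk.trans h⟩

/-- Existence of an optimal labelling. -/
theorem exists_labels_mms {I : FDInstance n ℓ m} {ε : ℝ} {s : Memory} (h : I.Input ε s)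
    (hn : 0 < n) (i : Fin n) : ∃ A : ℕ → ℕ, (∀ g < m, A g < n) ∧
      RespectsQuotas n ℓ m (s.nat 1) (s.nat 2) (s.nat 3) A ∧
      (∀ k < n, I.mms i ≤ bundleSum m A (s.real (i + 1)) k) ∧
      ∃ k < n, bundleSum m A (s.real (i + 1)) k = I.mms i := by
  obtain ⟨P, hP, h1, k, hk⟩ := I.exists_mms_eq hn i
  obtain ⟨A, hA, rfl⟩ := exists_labels hP.1
  simp only [value_ofLabels h] at h1 hk
  exact ⟨A, hA, (feasibleAllocation_ofLabels h hA).1 hP, fun k hk => h1 ⟨k, hk⟩, k, k.2, hk⟩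

/-- A most valuable bundle has at least the maximin share. -/
theorem mms_le_of_forall_le {I : FDInstance n ℓ m} {ε : ℝ} {s : Memory} (h : I.Input ε s)
    (hn : 0 < n) (i : Fin n) {A : ℕ → ℕ} (hA : ∀ g < m, A g < n) {x : ℝ}
    (hx : ∀ k < n, bundleSum m A (s.real (i + 1)) k ≤ x) : I.mms i ≤ x := by
  obtain ⟨A', hA', -, h1, -⟩ := exists_labels_mms h hn i
  -- Both labellings distribute the same total value: `n` shares do not exceed it, and it does not
  -- exceed `n * x`.
  have h2 : n * I.mms i ≤ n * x := by
    calc n * I.mms i = ∑ k ∈ range n, I.mms i := by simp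
      _ ≤ ∑ k ∈ range n, bundleSum m A' (s.real (i + 1)) k :=
          sum_le_sum fun k hk => h1 k (mem_range.1 hk)
      _ = ∑ k ∈ range n, bundleSum m A (s.real (i + 1)) k := by
          rw [sum_bundleSum hA', sum_bundleSum hA]
      _ ≤ ∑ k ∈ range n, x := sum_le_sum fun k hk => hx k (mem_range.1 hk)
      _ = n * x := by simp
  exact le_of_mul_le_mul_left h2 (by exact_mod_cast hn)

end FDInstance

/-! ### Assembling the algorithm and identifying the exceptional agent -/

namespace RAM

open NatExpr Program

/-! ### The whole algorithm -/

/-- The algorithm for the exceptional agent `e` and the valuation of the agent `c` for all others. -/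
def mainProg (n ℓ e c : ℕ) : Program := searchProg n ℓ (c + 1) ⨟ chooseProg n e (e + 1)

/-- Reset the variable `33` if some agent in the list differs from the agent `c`. -/
def compareProg (c : ℕ) : List ℕ → Program
  | [] => .skip
  | i :: l => .forRange 23 (.var 0) (.ite (.and
      (.realLe (.read (i + 1) (.var 23)) (.read (c + 1) (.var 23)))
      (.realLe (.read (c + 1) (.var 23)) (.read (i + 1) (.var 23)))) .skip
      (.setNat 33 (.const 0) (.const 0))) ⨟ compareProg c l

/-- Outside of the arrays `23` and `33` of naturals, the memories are equal. -/
def AgreeOff (s s' : Memory) : Prop :=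
  s'.real = s.real ∧ ∀ a, a ≠ 23 → a ≠ 33 → s'.nat a = s.nat a

theorem AgreeOff.trans {s₁ s₂ s₃ : Memory} (h : AgreeOff s₁ s₂) (h' : AgreeOff s₂ s₃) :
    AgreeOff s₁ s₃ :=
  ⟨h'.1.trans h.1, fun a ha ha' => (h'.2 a ha ha').trans (h.2 a ha ha')⟩

theorem run_compareProg {c N : ℕ} (l : List ℕ) {s : Memory} (hmN : s.nat 0 0 ≤ N) :
    Run N (compareProg c l) s fun s' => AgreeOff s s' ∧ (s'.nat 33 0 = 1 ↔ s.nat 33 0 = 1 ∧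
      ∀ i ∈ l, ∀ g < s.nat 0 0, s.real (i + 1) g = s.real (c + 1) g) := by
  induction l generalizing s with
  | nil => exact Run.skip (by simp [AgreeOff])
  | cons i l ih =>
    refine Run.seq (Run.forRange (fun j s' => AgreeOff s s' ∧ (s'.nat 33 0 = 1 ↔
      s.nat 33 0 = 1 ∧ ∀ g < j, s.real (i + 1) g = s.real (c + 1) g)) (s.nat 0 0) hmN rfl
      (fun s' hf => by simp [hf.nat 0 rfl]) ?_ ?_) ?_
    · simp +contextual [AgreeOff]
    · rintro j s' hj hf hj' ⟨h1, h2⟩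
      refine Run.ite (fun hb => Run.skip ?_) fun hb => Run.setNat ?_ <;>
        simp only [Test.Holds, RealExpr.eval, eval, hj', h1.1, ← le_antisymm_iff] at hb <;>
        simp only [Nat.forall_lt_succ_right]
      · exact ⟨h1.trans ⟨rfl, fun a ha _ => by simp [ha]⟩, by simp [h2, hb]⟩
      · exact ⟨h1.trans ⟨rfl, fun a ha ha' => by simp [ha, ha']⟩, by simp [hb]⟩
    · rintro s₁ hf₁ ⟨h1, h2⟩
      have e0 := h1.2 0 (by decide) (by decide)
      refine (ih (by rw [e0]; exact hmN)).imp ?_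
      rintro s' - ⟨h3, h4⟩
      refine ⟨h1.trans h3, ?_⟩
      rw [h4, h2, e0, h1.1, List.forall_mem_cons, and_assoc]

/-- An agent other than `e`, if there is one. -/
def refAgent (n e : ℕ) : ℕ := if e = 0 then min 1 (n - 1) else 0

/-- Find an agent such that all others are identical, and run the algorithm for this agent. -/
def chainProg (n ℓ : ℕ) : List ℕ → Program
  | [] => .skip
  | e :: l => .setNat 33 (.const 0) (.const 1) ⨟
      compareProg (refAgent n e) ((List.range n).filter (· ≠ e)) ⨟
      .ite (.natEq (.var 33) (.const 1)) (mainProg n ℓ e (refAgent n e)) (chainProg n ℓ l)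

/-- The input does not name the exceptional agent, so candidates are tested one after another. The
main program runs for the first one that passes, and any such candidate is good enough. -/
theorem run_chainProg {n ℓ N : ℕ} (l : List ℕ) {s : Memory} {Q : Memory → Prop}
    (hmN : s.nat 0 0 ≤ N)
    (hex : ∃ e ∈ l, ∀ i < n, i ≠ e → ∀ g < s.nat 0 0,
      s.real (i + 1) g = s.real (refAgent n e + 1) g)
    (hrun : ∀ e ∈ l, (∀ i < n, i ≠ e → ∀ g < s.nat 0 0,
      s.real (i + 1) g = s.real (refAgent n e + 1) g) →
      ∀ s', AgreeOff s s' → Run N (mainProg n ℓ e (refAgent n e)) s' Q) :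
    Run N (chainProg n ℓ l) s Q := by
  induction l generalizing s with
  | nil => simp at hex
  | cons e l ih =>
    refine Run.setNat_seq (Run.seq (run_compareProg _ (by simpa using hmN)) ?_)
    rintro s₁ hf₁ ⟨h1, h2⟩
    have hs₁ : AgreeOff s s₁ :=
      AgreeOff.trans (s₂ := s.setNat 33 0 1) ⟨rfl, fun a _ ha => by simp [ha]⟩ h1
    have h2' : s₁.nat 33 0 = 1 ↔ ∀ i < n, i ≠ e → ∀ g < s.nat 0 0,
        s.real (i + 1) g = s.real (refAgent n e + 1) g := by
      rw [h2]; simp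
    refine Run.ite (fun hb => ?_) fun hb => ?_ <;>
      simp only [Test.Holds, eval, ← le_antisymm_iff, h2'] at hb
    · exact hrun e (by simp) hb s₁ hs₁
    · have e0 := hs₁.2 0 (by decide) (by decide)
      refine ih (by rw [e0]; exact hmN) ?_ fun e' he' h s' hs' => ?_
      · obtain ⟨e', he', h⟩ := hex
        rcases List.mem_cons.1 he' with rfl | he'
        · exact absurd h hb
        · exact ⟨e', he', by rw [e0, hs₁.1]; exact h⟩
      · rw [e0, hs₁.1] at h
        exact hrun e' (List.mem_cons_of_mem _ he') h s' (hs₁.trans hs')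

end RAM

namespace FDInstance

open RAM

variable {n ℓ m : ℕ}

theorem AlmostIdentical.exists_agent {I : FDInstance n ℓ m} (h : I.AlmostIdentical) (hn : 0 < n) :
    ∃ e < n, ∃ hc : refAgent n e < n, ∀ i : Fin n, (i : ℕ) ≠ e →
      ∀ g, I.val i g = I.val ⟨refAgent n e, hc⟩ g := by
  obtain ⟨E, hE, h⟩ := h
  obtain ⟨e, he⟩ : ∃ e : Fin n, E ⊆ {e} := by
    rcases E.eq_empty_or_nonempty with rfl | ⟨e, he⟩
    · exact ⟨⟨0, hn⟩, by simp⟩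
    · exact ⟨e, fun i hi => by rw [mem_singleton]; exact card_le_one.1 hE i hi e he⟩
  have hc : refAgent n e < n := by unfold refAgent; split_ifs <;> omega
  refine ⟨e, e.2, hc, fun i hi g => ?_⟩
  -- An agent `i ≠ e` exists here, so `n ≥ 2` and the reference agent is not `e`.
  have hne : refAgent n e ≠ e := by unfold refAgent; split_ifs <;> omega
  have hE' : ∀ i : Fin n, (i : ℕ) ≠ e → i ∉ E := fun i hi hiE =>
    hi (congrArg Fin.val (mem_singleton.1 (he hiE)))
  simpa [value] using congrFun (h i ⟨refAgent n e, hc⟩ (hE' i hi) (hE' _ hne)) {g}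

/-- Goods with factor `1 - ε`, or chores with factor `1 + ε`. -/
def GoodsOrChores (I : FDInstance n ℓ m) (ε α : ℝ) : Prop :=
  (I.IsGoods ∧ α = 1 - ε) ∨ (I.IsChores ∧ α = 1 + ε)

section

variable {I : FDInstance n ℓ m} {ε α : ℝ} {s : Memory}

theorem Input.cat_lt (h : I.Input ε s) : ∀ g < m, s.nat 1 g < ℓ := fun g hg => by
  rw [h.cat ⟨g, hg⟩]; exact Fin.is_lt _

/-- Shares are nonnegative for goods and nonpositive for chores, so in both cases the factor only
weakens the demand. This serves the exceptional agent, who obtains the full share. -/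
theorem mul_mms_le_mms (h : I.Input ε s) (hn : 0 < n) (hε : 0 < ε) (hI : I.GoodsOrChores ε α)
    (i : Fin n) : α * I.mms i ≤ I.mms i := by
  obtain ⟨A, -, -, -, k, -, hk⟩ := exists_labels_mms h hn i
  have hv : ∀ g ∈ {g ∈ range m | A g = k}, ∃ g' : Fin m, s.real (i + 1) g = I.val i g' :=
    fun g hg => ⟨⟨g, mem_range.1 (mem_filter.1 hg).1⟩, h.val i ⟨g, _⟩⟩
  rcases hI with ⟨hI, rfl⟩ | ⟨hI, rfl⟩
  · have : 0 ≤ I.mms i := hk ▸ sum_nonneg fun g hg => by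
      obtain ⟨g', hg'⟩ := hv g hg; rw [hg']; exact hI i g'
    nlinarith
  · have : I.mms i ≤ 0 := hk ▸ sum_nonpos fun g hg => by
      obtain ⟨g', hg'⟩ := hv g hg; rw [hg']; exact hI i g'
    nlinarith

/-- The quality of the allocation found by the search. -/
theorem mul_mms_le_of_search (h : I.Input ε s) (hn : 0 < n) (hε : 0 < ε)
    (hI : I.GoodsOrChores ε α) (c : Fin n) {k : ℕ} (hk : 1 ≤ k) (hkε : 1 ≤ k * ε) {s' : Memory}
    (hbest : IsBest n ℓ m (s.nat 1) (s.nat 2) (s.nat 3) (s.real (c + 1)) s')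
    (hsearch : ∀ w < m, ∃ r : ℕ → ℕ,
      (∀ g < m, IsRound (m * k) (m * (m * k)) |s.real (c + 1) w| |s.real (c + 1) g| (r g)) ∧
      ∀ A : ℕ → ℕ, (∀ g < m, A g < n) → ∃ A' : ℕ → ℕ, (∀ g < m, A' g < n) ∧
        key (weight n ℓ (digitBase m k) (s.nat 1) r) A m =
          key (weight n ℓ (digitBase m k) (s.nat 1) r) A' m ∧
        Dominates n ℓ m (s.nat 1) (s.nat 2) (s.nat 3) (s.real (c + 1)) A' s')
    {i : Fin n} (hi : ∀ g, I.val i g = I.val c g) :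
    (∀ g < m, s'.nat 4 g < n) ∧
    RespectsQuotas n ℓ m (s.nat 1) (s.nat 2) (s.nat 3) (s'.nat 4) ∧
    ∀ b < n, α * I.mms i ≤ bundleSum m (s'.nat 4) (s.real (c + 1)) b := by
  obtain ⟨A, hA, hq, hlow, b₀, hb₀, hb₀'⟩ := exists_labels_mms h hn i
  have hu : ∀ g < m, s.real (i + 1) g = s.real (c + 1) g := fun g hg => by
    rw [h.val i ⟨g, hg⟩, h.val c ⟨g, hg⟩, hi]
  have hsum : ∀ A b, bundleSum m A (s.real (i + 1)) b = bundleSum m A (s.real (c + 1)) b :=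
    fun A b => sum_congr rfl fun g hg => hu g (mem_range.1 (mem_filter.1 hg).1)
  simp only [hsum] at hlow hb₀'
  set u := s.real (c + 1) with hudef
  set μ := I.mms i with hμ
  have hk0 : (0 : ℝ) < k := by exact_mod_cast hk
  have hkε' : 1 / (k : ℝ) ≤ ε := by rw [div_le_iff₀ hk0]; linarith
  -- The reconstructed `A'` shares its key with the optimal `A`, so it respects the quotas and the
  -- search dominates it.
  have hex : ∀ w < m, ∃ r : ℕ → ℕ,
      (∀ g < m, IsRound (m * k) (m * (m * k)) |u w| |u g| (r g)) ∧ ∃ A' : ℕ → ℕ,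
      (∀ b < n, bundleRound m A r b = bundleRound m A' r b) ∧
      s'.nat 18 0 = 1 ∧ ∃ b' < n, bundleSum m A' u b' ≤ s'.real 0 5 := by
    intro w hw
    obtain ⟨r, hr, hs⟩ := hsearch w hw
    obtain ⟨A', hA', hkey, hd⟩ := hs A hA
    have heq := fun {b} (hb : b < n) =>
      eq_of_key_eq h.cat_lt (fun g hg => (hr g hg).le_cap) hA hA' hkey hb
    have hq' : RespectsQuotas n ℓ m (s.nat 1) (s.nat 2) (s.nat 3) A' := fun b hb j hj => by
      rw [← (heq hb).2 j hj]; exact hq b hb j hj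
    exact ⟨r, hr, A', fun b hb => (heq hb).1, hd hq'⟩
  have hfeas : (∀ g < m, s'.nat 4 g < n) ∧
      RespectsQuotas n ℓ m (s.nat 1) (s.nat 2) (s.nat 3) (s'.nat 4) := by
    rcases Nat.eq_zero_or_pos m with h0 | h0
    -- Without items there is no unit to try, and every labelling is as good as `A`.
    · exact ⟨fun g hg => by omega, hq.congr fun g hg => by omega⟩
    · obtain ⟨r, -, A', -, h1, -⟩ := hex 0 h0
      exact ⟨(hbest h1).1, (hbest h1).2.1⟩
  refine ⟨hfeas.1, hfeas.2, fun b hb => ?_⟩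
  rcases hI with ⟨hI, rfl⟩ | ⟨hI, rfl⟩
  · have hpos : ∀ g < m, 0 ≤ u g := fun g hg => by
      rw [hudef, h.val c ⟨g, hg⟩]; exact hI c _
    have hsum0 : ∀ A b, 0 ≤ bundleSum m A u b := fun A b =>
      sum_nonneg fun g hg => hpos g (mem_range.1 (mem_filter.1 hg).1)
    have hμ0 : 0 ≤ μ := hb₀' ▸ hsum0 A b₀
    rcases hμ0.eq_or_lt with h0 | h0
    · rw [← h0, mul_zero]; exact hsum0 _ _
    · have hne : {g ∈ range m | A g = b₀}.Nonempty := by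
        rw [nonempty_iff_ne_empty]
        intro he
        rw [← hb₀', bundleSum, he, sum_empty] at h0
        exact lt_irrefl _ h0
      -- The unit for goods is a most valuable item of the poorest bundle `b₀`, which is nonempty
      -- because `μ > 0`.
      obtain ⟨w, hw, hmax⟩ := exists_max_image _ u hne
      have hwm := mem_range.1 (mem_filter.1 hw).1
      obtain ⟨r, hr, A', hA', h1, b', hb', h2⟩ := hex w hwm
      have hwμ : u w ≤ μ := hb₀' ▸ single_le_sum
        (fun g hg => hpos g (mem_range.1 (mem_filter.1 hg).1)) hw
      have hμw : μ ≤ m * u w := by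
        calc μ ≤ #{g ∈ range m | A g = b₀} • u w := hb₀' ▸ sum_le_card_nsmul _ _ _ hmax
          _ ≤ m * u w := by
            rw [nsmul_eq_mul]
            have := card_filter_range_le m (A · = b₀)
            have := hpos w hwm
            gcongr
      have h3 := bundleSum_goods_of_round (by omega) (by omega) hpos hwm hr (hA' b' hb')
        (hlow b' hb') hwμ hμw
      have h4 := (hbest h1).2.2 b hb
      have h5 : (1 - ε) * μ ≤ (1 - 1 / k) * μ := by gcongr
      linarith
  · have hneg : ∀ g < m, u g ≤ 0 := fun g hg => by
      rw [hudef, h.val c ⟨g, hg⟩]; exact hI c _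
    have hsum0 : ∀ A b, bundleSum m A u b ≤ 0 := fun A b =>
      sum_nonpos fun g hg => hneg g (mem_range.1 (mem_filter.1 hg).1)
    have hμ0 : μ ≤ 0 := hb₀' ▸ hsum0 A b₀
    by_cases hall : ∀ g < m, u g = 0
    · have : bundleSum m (s'.nat 4) u b = 0 :=
        sum_eq_zero fun g hg => hall g (mem_range.1 (mem_filter.1 hg).1)
      rw [this]
      exact mul_nonpos_of_nonneg_of_nonpos (by linarith) hμ0
    · push Not at hall
      obtain ⟨g₀, hg₀, hug₀⟩ := hall
      -- The unit for chores is a worst item. The bundle of `A` containing it yields `μ ≤ u w`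
      -- below.
      obtain ⟨w, hw, hmin⟩ := exists_min_image (range m) u ⟨g₀, mem_range.2 hg₀⟩
      have hwm := mem_range.1 hw
      have hw0 : u w < 0 := (hmin g₀ (mem_range.2 hg₀)).trans_lt (lt_of_le_of_ne (hneg _ hg₀) hug₀)
      obtain ⟨r, hr, A', hA', h1, b', hb', h2⟩ := hex w hwm
      have h3 := bundleSum_chores_of_round (by omega) (by omega) hneg hwm hw0
        (fun g hg => hmin g (mem_range.2 hg)) hr (hA' b' hb')
      have h4 := (hbest h1).2.2 b hb
      have h5 := hlow b' hb'
      have hμw : μ ≤ u w := by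
        refine (hlow (A w) (hA w hwm)).trans ?_
        have := single_le_sum (f := fun g => - u g) (s := {g ∈ range m | A g = A w})
          (fun g hg => neg_nonneg.2 (hneg g (mem_range.1 (mem_filter.1 hg).1)))
          (mem_filter.2 ⟨hw, rfl⟩)
        simp only [sum_neg_distrib] at this
        unfold bundleSum
        linarith
      have h6 : ε * μ ≤ u w / k := by
        calc ε * μ ≤ 1 / k * μ := mul_le_mul_of_nonpos_right hkε' hμ0
          _ ≤ 1 / k * u w := by gcongr
          _ = u w / k := by ring
      linarith

theorem run_mainProg {e N N₀ : ℕ} (h : I.Input ε s) (hε : 0 < ε) (hI : I.GoodsOrChores ε α)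
    (he : e < n) (hc : refAgent n e < n)
    (hid : ∀ i : Fin n, (i : ℕ) ≠ e → ∀ g, I.val i g = I.val ⟨refAgent n e, hc⟩ g)
    (hN₀ : 1 ≤ N₀ * ε) (hN : ∀ k ≤ N₀ + 1, tableSize n ℓ m k + k + n + ℓ + 1 ≤ N) :
    Run N (mainProg n ℓ e (refAgent n e)) s fun s' =>
      I.IsMMSAllocation α (outputAllocation n m s') := by
  have hn : 0 < n := by omega
  have hNm : m ≤ N := (lt_tableSize n ℓ m 0).le.trans (by have := hN 0 (by omega); omega)
  refine Run.seq (run_searchProg (N₀ := N₀) hn (by rw [h.accuracy]; exact hε.le)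
    (by rw [h.accuracy]; exact hN₀) (by rw [h.items]; exact hN)
    (by rw [h.items]; exact h.cat_lt)) ?_
  rintro s₁ hf₁ ⟨hbest, k, hk, hkε, hsearch⟩
  rw [h.items] at hbest hsearch
  rw [h.accuracy] at hkε
  have hq := fun {i : Fin n} (hi : ∀ g, I.val i g = I.val ⟨refAgent n e, hc⟩ g) =>
    mul_mms_le_of_search h hn hε hI ⟨refAgent n e, hc⟩ hk hkε hbest hsearch hi
  obtain ⟨hlab, hquot, -⟩ := hq fun _ => rfl
  have e0 : s₁.nat 0 0 = m := by rw [hf₁.nat 0 rfl, h.items]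
  have er : s₁.real (e + 1) = s.real (e + 1) := hf₁.real rfl e
  refine (run_chooseProg hn (by omega) (by have := hN 0 (by omega); omega)).imp ?_
  rintro s₂ - ⟨b, hb, hmax, hout⟩
  rw [e0, er] at hmax
  rw [e0] at hout
  have hswap : ∀ k < n, Equiv.swap b e k < n := fun k hk => by
    rw [Equiv.swap_apply_def]; split_ifs <;> omega
  have hlab' : ∀ g < m, s₂.nat 4 g < n := fun g hg => by
    rw [hout g hg]; exact hswap _ (hlab g hg)
  have hiff : ∀ g < m, ∀ k, s₂.nat 4 g = k ↔ s₁.nat 4 g = Equiv.swap b e k := fun g hg k => by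
    rw [hout g hg, ← Equiv.eq_symm_apply, Equiv.symm_swap]
  have hcount : ∀ k j, bundleCount m (s₂.nat 4) (s.nat 1) k j =
      bundleCount m (s₁.nat 4) (s.nat 1) (Equiv.swap b e k) j := fun k j => by
    unfold bundleCount
    rw [filter_congr fun g hg => by rw [hiff g (mem_range.1 hg)]]
  have hsum : ∀ u k, bundleSum m (s₂.nat 4) u k =
      bundleSum m (s₁.nat 4) u (Equiv.swap b e k) := fun u k => by
    unfold bundleSum
    rw [filter_congr fun g hg => by rw [hiff g (mem_range.1 hg)]]
  refine ⟨(feasibleAllocation_ofLabels h hlab').2 fun k hk j hj => ?_, fun i => ?_⟩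
  · rw [hcount]; exact hquot _ (hswap k hk) j hj
  · refine le_of_le_of_eq ?_ (value_ofLabels (A := s₂.nat 4) h i i).symm
    rw [hsum]
    by_cases hie : (i : ℕ) = e
    -- After the swap, label `e` carries the bundle `b`, a most valuable one for the exceptional
    -- agent.
    · rw [hie, Equiv.swap_apply_right, ← hie]
      exact (mul_mms_le_mms h hn hε hI i).trans
        (mms_le_of_forall_le h hn i hlab (by rw [hie]; exact hmax))
    · refine ((hq (hid i hie)).2.2 _ (hswap i i.2)).trans_eq (sum_congr rfl fun g hg => ?_)
      have hg' := mem_range.1 (mem_filter.1 hg).1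
      rw [h.val i ⟨g, hg'⟩, hid i hie]
      exact h.val ⟨refAgent n e, hc⟩ ⟨g, hg'⟩

end

/-- A bound for the number of rounds of all loops. -/
def loopBound (n ℓ x : ℕ) : ℕ := tableSize n ℓ x (x + 1) + (x + 1) + n + ℓ + 1

/-- Here it matters that `n` and `ℓ` are constants: they occur as exponents in the table size. -/
theorem polyBdd_loopBound (n ℓ : ℕ) : PolyBdd (loopBound n ℓ) := by
  unfold loopBound tableSize digitBase
  fun_prop

theorem tableSize_mono {n ℓ m m' k k' : ℕ} (hm : m ≤ m') (hk : k ≤ k') :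
    tableSize n ℓ m k ≤ tableSize n ℓ m' k' := by
  unfold tableSize digitBase
  gcongr

theorem run_chainProg_initMemory {I : FDInstance n ℓ m} {ε α : ℝ} (hε : 0 < ε)
    (hI : I.GoodsOrChores ε α) (hid : I.AlmostIdentical) :
    Run (loopBound n ℓ (m + ⌈ε⁻¹⌉₊)) (chainProg n ℓ (List.range n)) (I.initMemory ε) fun s' =>
      I.IsMMSAllocation α (outputAllocation n m s') := by
  have h := I.input_initMemory ε
  rcases Nat.eq_zero_or_pos n with rfl | hn
  -- Without agents, the upper quotas force the set of items to be empty, and the program is `skip`.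
  · have hm : ∀ g : Fin m, False := fun g => by
      have := I.le_hi_mul (I.cat g)
      rw [mul_zero, Nat.le_zero, card_eq_zero, filter_eq_empty_iff] at this
      exact this (mem_univ g) rfl
    exact Run.skip ⟨⟨fun g => (hm g).elim, fun i => i.elim0⟩, fun i => i.elim0⟩
  · have hN : ∀ k ≤ ⌈ε⁻¹⌉₊ + 1,
        tableSize n ℓ m k + k + n + ℓ + 1 ≤ loopBound n ℓ (m + ⌈ε⁻¹⌉₊) := fun k hk => by
      have := tableSize_mono (n := n) (ℓ := ℓ) (m := m) (m' := m + ⌈ε⁻¹⌉₊) (by omega)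
        (by omega : k ≤ m + ⌈ε⁻¹⌉₊ + 1)
      unfold loopBound
      omega
    have hN₀ : 1 ≤ (⌈ε⁻¹⌉₊ : ℝ) * ε := by
      calc 1 = ε⁻¹ * ε := (inv_mul_cancel₀ hε.ne').symm
        _ ≤ _ := by gcongr; exact Nat.le_ceil _
    obtain ⟨e, he, hc, hid⟩ := hid.exists_agent hn
    refine run_chainProg _ ?_ ⟨e, List.mem_range.2 he, fun i hi hie g hg => ?_⟩ ?_
    · rw [h.items]
      have := lt_tableSize n ℓ m 0
      have := hN 0 (by omega)
      omega
    · rw [h.items] at hg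
      rw [h.val ⟨i, hi⟩ ⟨g, hg⟩, hid _ hie]
      exact (h.val ⟨refAgent n e, hc⟩ ⟨g, hg⟩).symm
    · intro e he hid s' hs'
      rw [h.items] at hid
      have he := List.mem_range.1 he
      have hc : refAgent n e < n := by unfold refAgent; split_ifs <;> omega
      refine run_mainProg (h.congr (fun a ha => hs'.2 a (by omega) (by omega)) hs'.1) hε hI he hc
        (fun i hie g => ?_) hN₀ hN
      rw [← h.val, ← h.val]
      exact hid i i.2 hie g g.2

/-- The same program serves goods and chores: it rounds absolute values and maximizes the least true
value in either case. -/
theorem exists_program (n ℓ : ℕ) : ∃ (p : Program) (c d : ℕ), ∀ (m : ℕ) (I : FDInstance n ℓ m)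
    (ε α : ℝ), 0 < ε → I.GoodsOrChores ε α → I.AlmostIdentical →
      I.ComputesMMS p ε α (c * (m + ε⁻¹ + 1) ^ d) := by
  obtain ⟨c, d, hcd⟩ := (chainProg n ℓ (List.range n)).polyBdd_timeBound.comp
    (polyBdd_loopBound n ℓ)
  refine ⟨chainProg n ℓ (List.range n), c * 2 ^ d, d, fun m I ε α hε hI hid => ?_⟩
  obtain ⟨s', t, hexec, ht, hs'⟩ := run_chainProg_initMemory hε hI hid
  refine ⟨s', t, hexec, ?_, hs'⟩
  have hε' : 0 < ε⁻¹ := inv_pos.2 hε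
  have hceil := Nat.ceil_lt_add_one hε'.le
  calc (t : ℝ) ≤ (c * (m + ⌈ε⁻¹⌉₊ + 1) ^ d : ℕ) := by exact_mod_cast ht.trans (hcd _)
    _ = c * (m + ⌈ε⁻¹⌉₊ + 1 : ℝ) ^ d := by push_cast; ring
    -- Rounding `ε⁻¹` up adds less than `1`, which the factor `2` absorbs; this is why the constant
    -- is `c * 2 ^ d`.
    _ ≤ c * (2 * (m + ε⁻¹ + 1)) ^ d := by
      have : (0 : ℝ) ≤ m := Nat.cast_nonneg m
      gcongr
      linarith
    _ = _ := by push_cast; rw [mul_pow]; ring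

end FDInstance

/-- For all constants `n` (agents) and `ℓ` (categories) there is a program, for goods and for
chores respectively, that receives an instance with almost identical agents and any real `ε > 0`, and
computes a `(1 - ε)`-MMS (`(1 + ε)`-MMS) allocation in time polynomial in the number `m` of items
and `1 / ε`.  Every instance with two agents is among these. -/
theorem mainTheorem11 (n ℓ : ℕ) :
    (∃ (p : RAM.Program) (c d : ℕ), ∀ (m : ℕ) (I : FDInstance n ℓ m) (ε : ℝ), 0 < ε →
      I.IsGoods → I.AlmostIdentical →
        I.ComputesMMS p ε (1 - ε) (c * (m + ε⁻¹ + 1) ^ d)) ∧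
    (∃ (p : RAM.Program) (c d : ℕ), ∀ (m : ℕ) (I : FDInstance n ℓ m) (ε : ℝ), 0 < ε →
      I.IsChores → I.AlmostIdentical →
        I.ComputesMMS p ε (1 + ε) (c * (m + ε⁻¹ + 1) ^ d)) ∧
    (n = 2 → ∀ (m : ℕ) (I : FDInstance n ℓ m), I.AlmostIdentical) := by
  obtain ⟨p, c, d, h⟩ := FDInstance.exists_program n ℓ
  refine ⟨⟨p, c, d, fun m I ε hε hI => h m I ε _ hε (.inl ⟨hI, rfl⟩)⟩,
    ⟨p, c, d, fun m I ε hε hI => h m I ε _ hε (.inr ⟨hI, rfl⟩)⟩, ?_⟩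
  rintro rfl m I
  refine ⟨{0}, by simp, fun i i' hi hi' => ?_⟩
  rw [mem_singleton] at hi hi'
  rw [(by omega : i = i')]
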